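/- Let $0<d<k$ be integers. For a linear map $L:\mathbb{R}^d\to\mathbb{R}^{k-d}$ let $E=\{(x,L(x)) : x\in\mathbb{R}^d\}\subset\mathbb{R}^k$. Let $F\subset\mathbb{R}^k$ be a linear subspace complementary to $E$ such that the projection $\pi$ onto $E$ along $F$ is injective on $\mathbb{Z}^k$, and let $\pi^*$ be the projection onto $F$ along $E$. Put $\mathcal S=\pi^*(\{0\}^d\times[0,1]^{k-d})+E$, and for $s\in\mathbb{R}^k$ let $Y_s=\pi(\mathcal S\cap(\mathbb{Z}^k+s))$ be the corresponding cubical cut and project set. Call $s$ and $Y_s$ regular if $\partial\mathcal S\cap(\mathbb{Z}^k+s)=\emptyset$. For $y\in Y_s$ let $\tilde y$ be the unique point of $\mathbb{Z}^k+s$ with $\pi(\tilde y)=y$. For $r\ge 0$ the $r$-patch of $Y_s$ at $y$ is $$P(y,r)=\{y'\in Y_s : \tilde y'-\tilde y\in[-r,r]^d\times\mathbb{R}^{k-d}\};$$ two $r$-patches $P(y_1,r)$ and $P(y_2,r)$ are equivalent if $P(y_1,r)-y_1=P(y_2,r)-y_2$, and $\mathcal P(y,r)$ denotes the equivalence class of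 $P(y,r)$. For an equivalence class $\mathcal P$ of $r$-patches, $y\in Y_s$ and $R>0$ let $$\xi_{\mathcal P}(y,R)=\frac{\#\{y'\in Y_s : \mathcal P(y',r)=\mathcal P,\ \tilde y'-\tilde y\in[-R,R]^d\times\mathbb{R}^{k-d}\}}{\#\{y'\in Y_s : \tilde y'-\tilde y\in[-R,R]^d\times\mathbb{R}^{k-d}\}},\qquad \xi_{\mathcal P}=\lim_{R\to\infty}\xi_{\mathcal P}(y,R).$$ Theorem. Fix $\epsilon>0$. For Lebesgue-almost every linear map $L:\mathbb{R}^d\to\mathbb{R}^{k-d}$ (identified with its matrix in $\mathbb{R}^{d(k-d)}$) and every $F$ as above there is a constant $C>0$, depending only on $L$, $\epsilon$ and $\pi$, such that for every $r\ge0$ and every equivalence class $\mathcal P$ of $r$-patches of regular sets $Y_s$, the limit $\xi_{\mathcal P}$ exists and does not depend on the regular $s\in\mathbb{R}^k$ or on $y\in Y_s$, and $$|\xi_{\mathcal P}(y,R)-\xi_{\mathcal P}|\le C\,\frac{(\log R)^{k+\epsilon}}{R^d}$$ for every regular $s\in\mathbb{R}^k$, every $y\in Y_s$ and every real $R\ge2$.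 -/

import Mathlib

open Filter Topology MeasureTheory
open scoped Pointwise

noncomputable section

namespace CutProject

/-- The total space `ℝᵏ = ℝᵈ × ℝᵐ`, where `k = d + m`. -/
abbrev TotalSpace (d m : ℕ) : Type := (Fin d → ℝ) × (Fin m → ℝ)

/-- The linear map `L : ℝᵈ → ℝᵐ` with coefficients `α`, that is `L(x)ᵢ = ∑ⱼ αᵢⱼ xⱼ`. -/
def linearMapOf {d m : ℕ} (α : Fin m → Fin d → ℝ) : (Fin d → ℝ) →ₗ[ℝ] (Fin m → ℝ) :=
  Matrix.mulVecLin (Matrix.of α)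

/-- The integer lattice `ℤᵏ` in the total space. -/
def lattice (d m : ℕ) : Set (TotalSpace d m) :=
  {z | (∀ i, ∃ a : ℤ, z.1 i = a) ∧ (∀ j, ∃ b : ℤ, z.2 j = b)}

/-- The translated lattice `ℤᵏ + s`. -/
def shiftedLattice {d m : ℕ} (s : TotalSpace d m) : Set (TotalSpace d m) :=
  {z | z - s ∈ lattice d m}

/-- The cylinder `C(r)` of lattice points whose first `d` coordinates lie in `[-r, r]ᵈ`. -/
def cylinder (d m : ℕ) (r : ℝ) : Set (TotalSpace d m) :=
  {n | n ∈ lattice d m ∧ ∀ i, n.1 i ∈ Set.Icc (-r) r}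

/-- The cube `{0}ᵈ × [0, 1]ᵐ`. -/
def cube (d m : ℕ) : Set (TotalSpace d m) :=
  {z | z.1 = 0 ∧ ∀ j, z.2 j ∈ Set.Icc (0 : ℝ) 1}

/-- The physical space `E = {(x, L x)}`. -/
def physicalSpace {d m : ℕ} (L : (Fin d → ℝ) →ₗ[ℝ] (Fin m → ℝ)) :
    Submodule ℝ (TotalSpace d m) :=
  L.graph

section scheme

variable {d m : ℕ} (L : (Fin d → ℝ) →ₗ[ℝ] (Fin m → ℝ)) (F : Submodule ℝ (TotalSpace d m))
  (hF : IsCompl (physicalSpace L) F)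

/-- The projection `π` onto the physical space `E` along the internal space `F`. -/
def proj : TotalSpace d m →ₗ[ℝ] TotalSpace d m :=
  (physicalSpace L).projection F hF

/-- The projection `π*` onto the internal space `F` along the physical space `E`. -/
def projStar : TotalSpace d m →ₗ[ℝ] TotalSpace d m :=
  F.projection (physicalSpace L) hF.symm

/-- The cubical window in the internal space. -/
def window : Set (TotalSpace d m) := projStar L F hF '' cube d m

/-- The slice: the window plus the physical space. -/
def slice : Set (TotalSpace d m) :=
  window L F hF + (physicalSpace L : Set (TotalSpace d m))

/-- The cubical cut and project set `Y_s`, regarded as a subset of the total space. -/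
def cutProjectSet (s : TotalSpace d m) : Set (TotalSpace d m) :=
  proj L F hF '' (slice L F hF ∩ shiftedLattice s)

/-- Regularity of `s`: no point of `ℤᵏ + s` lies on the boundary of the slice. -/
def IsRegular (s : TotalSpace d m) : Prop :=
  frontier (slice L F hF) ∩ shiftedLattice s = ∅

/-- The lift of `y`: the point of `ℤᵏ + s` which `π` maps to `y`.  It is unique for `y ∈ Y_s`
when `π` is injective on `ℤᵏ`. -/
def lift (s y : TotalSpace d m) : TotalSpace d m :=
  Function.invFunOn (proj L F hF) (shiftedLattice s) y

/-- The `r`-patch `P(y, r)` of `Y_s` at `y`. -/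
def patch (s : TotalSpace d m) (r : ℝ) (y : TotalSpace d m) : Set (TotalSpace d m) :=
  {y' | y' ∈ cutProjectSet L F hF s ∧ lift L F hF s y' - lift L F hF s y ∈ cylinder d m r}

/-- The translated patch `P(y, r) - y`.  Two `r`-patches are equivalent exactly when these sets
agree, so this set stands for the equivalence class of `P(y, r)`. -/
def patchClass (s : TotalSpace d m) (r : ℝ) (y : TotalSpace d m) : Set (TotalSpace d m) :=
  (fun z => z - y) '' patch L F hF s r y

/-- `P` is an equivalence class of `r`-patches of the regular cubical cut and project sets of the
scheme. -/
def IsPatchClass (r : ℝ) (P : Set (TotalSpace d m)) : Prop :=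
  ∃ s, IsRegular L F hF s ∧ ∃ y ∈ cutProjectSet L F hF s, patchClass L F hF s r y = P

/-- The ratio `ξ_P(y, R)`: the proportion of the points of `Y_s` in the search region of size `R`
about `y` whose `r`-patch belongs to `P`. -/
def freqEstimate (s : TotalSpace d m) (r : ℝ) (P : Set (TotalSpace d m)) (y : TotalSpace d m)
    (R : ℝ) : ℝ :=
  (Set.ncard {y' | y' ∈ cutProjectSet L F hF s ∧ patchClass L F hF s r y' = P ∧
      lift L F hF s y' - lift L F hF s y ∈ cylinder d m R} : ℝ) /
    (Set.ncard {y' | y' ∈ cutProjectSet L F hF s ∧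
      lift L F hF s y' - lift L F hF s y ∈ cylinder d m R} : ℝ)

/-- `ξ` is the frequency `ξ_P`: the limit of `ξ_P(y, R)` as `R → ∞`, the same for every regular
cut and project set `Y_s` of the scheme and every `y ∈ Y_s`. -/
def IsFrequency (r : ℝ) (P : Set (TotalSpace d m)) (ξ : ℝ) : Prop :=
  ∀ s, IsRegular L F hF s → ∀ y ∈ cutProjectSet L F hF s,
    Tendsto (fun R : ℝ => freqEstimate L F hF s r P y R) atTop (𝓝 ξ)

end scheme

end CutProject

end

/-! A regular `Y_s` has exactly one point above each a in ℤᵈ, and the patch class at that point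
depends only on the fractional parts of the internal coordinates s.2 - L s.1 - L a. A given class
occurs exactly when this vector lies, modulo ℤᵐ, in a fixed box (`IsPatchClass.exists_box`). So
ξ_P(y, R) is the proportion of integer points of a cube at which m linear forms fall into a box
modulo 1, its limit is the volume of the box, and the theorem becomes a discrepancy bound uniform in
the box, the centre of the cube and the translation (`ae_exists_discrepancy_le`).

The discrepancy is bounded in the manner of Erdős and Turán. Majorizing arcs by trapezoids with
ramps of width δ costs O(δ) in the mean and leaves a sum over frequencies h ≠ 0 of weights times
exponential sums (`abs_sum_prod_arcIndicator_sub_le`). Each exponential sum over a cube is a product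
of d geometric sums, hence is at most a constant times a product of d peaks of height M evaluated at
the forms ∑ⱼ hⱼ αⱼᵢ (`norm_sum_expi_linearForm_le`).

Averaged over α in a cube, the product of peaks is O((log M)ᵈ) uniformly in h, while the weights sum
to O((log 1/δ)ᵐ). With δ = M⁻ᵈ the mean of `weightedPeakSum` is O((log M)ᵏ). A Borel–Cantelli
argument along M = 2^(2^i) costs the extra ε (`ae_exists_weightedPeakSum_le`). Passing from R to the
next scale loses only a constant, since the bounds depend on M through log M alone. -/

noncomputable section

namespace CutProject

/-! ### Fourier analysis of trapezoidal majorants of arcs -/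

/-- The character `x ↦ exp (2πix)`. -/
def expi (x : ℝ) : ℂ := Complex.exp (2 * Real.pi * x * Complex.I)

lemma expi_add (x y : ℝ) : expi (x + y) = expi x * expi y := by
  simp only [expi, ← Complex.exp_add]
  congr 1
  push_cast
  ring

lemma expi_zero : expi 0 = 1 := by simp [expi]

lemma norm_expi (x : ℝ) : ‖expi x‖ = 1 := by
  have : (2 * Real.pi * x * Complex.I : ℂ) = ((2 * Real.pi * x : ℝ) : ℂ) * Complex.I := by
    push_cast
    ring
  rw [expi, this, Complex.norm_exp_ofReal_mul_I]

lemma norm_expi_sub_one (x : ℝ) : ‖expi x - 1‖ = 2 * |Real.sin (Real.pi * x)| := by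
  have : (2 * Real.pi * x * Complex.I : ℂ) = Complex.I * ((2 * Real.pi * x : ℝ) : ℂ) := by
    push_cast
    ring
  rw [expi, this, Complex.norm_exp_I_mul_ofReal_sub_one, norm_mul, Real.norm_eq_abs,
    Real.norm_eq_abs, abs_two]
  congr 3
  ring

lemma norm_expi_sub_one_le (x : ℝ) : ‖expi x - 1‖ ≤ 2 * Real.pi * |x| := by
  rw [norm_expi_sub_one]
  have := Real.abs_sin_le_abs (x := Real.pi * x)
  rw [abs_mul, abs_of_pos Real.pi_pos] at this
  linarith

lemma expi_intCast (n : ℤ) : expi n = 1 := by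
  rw [expi, Complex.exp_eq_one_iff]
  exact ⟨n, by push_cast; ring⟩

lemma expi_finset_sum {ι : Type*} (s : Finset ι) (f : ι → ℝ) :
    expi (∑ i ∈ s, f i) = ∏ i ∈ s, expi (f i) := by
  simp only [expi, ← Complex.exp_sum]
  congr 1
  push_cast
  rw [Finset.mul_sum, Finset.sum_mul]

/-- The primitive of the floor function vanishing at `0`. -/
def floorPrimitive (y : ℝ) : ℝ := ⌊y⌋ * y - ⌊y⌋ * (⌊y⌋ + 1) / 2

lemma floorPrimitive_eq (y : ℝ) :
    floorPrimitive y = y ^ 2 / 2 - y / 2 - (Int.fract y ^ 2 - Int.fract y) / 2 := by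
  rw [floorPrimitive, Int.fract]
  ring

/-- `floorPrimitive` is convex, and the floor is a subgradient of it. -/
lemma floor_mul_sub_le (y z : ℝ) :
    ⌊y⌋ * (z - y) ≤ floorPrimitive z - floorPrimitive y := by
  unfold floorPrimitive
  have h1 := Int.floor_le z
  have h2 := Int.lt_floor_add_one z
  rcases lt_trichotomy ⌊y⌋ ⌊z⌋ with h | h | h
  · have h' : (⌊y⌋ : ℝ) + 1 ≤ ⌊z⌋ := by exact_mod_cast h
    nlinarith
  · rw [h]
    linarith
  · have h' : (⌊z⌋ : ℝ) + 1 ≤ ⌊y⌋ := by exact_mod_cast h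
    nlinarith

/-- The indicator function of `[a, b) + ℤ`, for `a ≤ b ≤ a + 1`. -/
def arcIndicator (a b x : ℝ) : ℝ := (⌊x - a⌋ : ℝ) - ⌊x - b⌋

/-- A piecewise linear majorant of `arcIndicator a b`. -/
def arcMajorant (a b δ x : ℝ) : ℝ :=
  (floorPrimitive (x - a + δ) - floorPrimitive (x - a) - floorPrimitive (x - b)
    + floorPrimitive (x - b - δ)) / δ

/-- The majorant replaces the first floor by its mean over an interval of length δ to the right of
`x - a`, and the second by its mean over one to the left of `x - b`. As the floor is monotone, the
first can only grow and the second only shrink. -/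
lemma arcIndicator_le_arcMajorant {a b δ : ℝ} (hδ : 0 < δ) (x : ℝ) :
    arcIndicator a b x ≤ arcMajorant a b δ x := by
  rw [arcIndicator, arcMajorant, le_div_iff₀ hδ]
  have h1 := floor_mul_sub_le (x - a) (x - a + δ)
  have h2 := floor_mul_sub_le (x - b) (x - b - δ)
  linarith

lemma arcIndicator_nonneg {a b : ℝ} (hab : a ≤ b) (x : ℝ) : 0 ≤ arcIndicator a b x := by
  have : ⌊x - b⌋ ≤ ⌊x - a⌋ := Int.floor_mono (by linarith)
  have : (⌊x - b⌋ : ℝ) ≤ ⌊x - a⌋ := by exact_mod_cast this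
  rw [arcIndicator]
  linarith

lemma one_sub_arcIndicator (a b x : ℝ) :
    1 - arcIndicator a b x = arcIndicator b (a + 1) x := by
  have : x - (a + 1) = x - a - 1 := by ring
  rw [arcIndicator, arcIndicator, this, Int.floor_sub_one]
  push_cast
  ring

/-- The Fourier coefficients of `arcMajorant a b δ`. -/
def arcCoeff (a b δ : ℝ) (h : ℤ) : ℂ :=
  if h = 0 then ((b - a + δ : ℝ) : ℂ) else
    -(1 / (4 * Real.pi ^ 2 * δ)) * (1 / (h : ℂ) ^ 2 * (expi (h * (δ - a)) - expi (h * (-a))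
      - expi (h * (-b)) + expi (h * (-b - δ))))

lemma hasSum_bernoulli_two (x : ℝ) :
    HasSum (fun n : ℤ => 1 / (n : ℂ) ^ 2 * expi (n * x))
      (2 * Real.pi ^ 2 * ((Int.fract x ^ 2 - Int.fract x + 6⁻¹ : ℝ) : ℂ)) := by
  have hx : Int.fract x ∈ Set.Icc (0 : ℝ) 1 := ⟨Int.fract_nonneg x, (Int.fract_lt_one x).le⟩
  have := hasSum_one_div_pow_mul_fourier_mul_bernoulliFun (le_refl 2) hx
  rw [bernoulliFun_two] at this
  convert this using 1
  · ext n
    congr 1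
    rw [fourier_coe_apply]
    have hx' : (n * x : ℝ) = n * Int.fract x + (n * ⌊x⌋ : ℤ) := by
      push_cast
      rw [Int.fract]
      ring
    rw [hx', expi_add, expi_intCast, mul_one, expi]
    congr 1
    push_cast
    ring
  · have : (-(2 * Real.pi * Complex.I) ^ 2 : ℂ) = 4 * Real.pi ^ 2 := by
      rw [mul_pow, Complex.I_sq]
      ring
    rw [this, Nat.factorial_two]
    push_cast
    ring

/-- By `floorPrimitive_eq` each primitive is a quadratic polynomial minus a periodic Bernoulli
function. In the signed combination of four the polynomials leave the constant `b - a + δ`, the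
mean, and the constants 1/6 cancel. -/
lemma hasSum_arcMajorant (a b : ℝ) {δ : ℝ} (hδ : 0 < δ) (x : ℝ) :
    HasSum (fun h : ℤ => arcCoeff a b δ h * expi (h * x)) (arcMajorant a b δ x) := by
  have h0 : HasSum (fun h : ℤ => if h = 0 then ((b - a + δ : ℝ) : ℂ) else 0)
      ((b - a + δ : ℝ) : ℂ) := hasSum_ite_eq 0 _
  have h1 := hasSum_bernoulli_two (x - a + δ)
  have h2 := hasSum_bernoulli_two (x - a)
  have h3 := hasSum_bernoulli_two (x - b)
  have h4 := hasSum_bernoulli_two (x - b - δ)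
  have h5 := h0.add (((((h1.sub h2).sub h3).add h4)).mul_left (-(1 / (4 * Real.pi ^ 2 * δ) : ℂ)))
  have hδ' : (δ : ℂ) ≠ 0 := by exact_mod_cast hδ.ne'
  have hpi : (Real.pi : ℂ) ≠ 0 := by exact_mod_cast Real.pi_ne_zero
  convert h5 using 1
  · ext h
    by_cases hh : h = 0
    · simp [hh, arcCoeff, expi_zero]
    · have e1 : (h * (x - a + δ) : ℝ) = h * (δ - a) + h * x := by ring
      have e2 : (h * (x - a) : ℝ) = h * (-a) + h * x := by ring
      have e3 : (h * (x - b) : ℝ) = h * (-b) + h * x := by ring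
      have e4 : (h * (x - b - δ) : ℝ) = h * (-b - δ) + h * x := by ring
      rw [e1, e2, e3, e4]
      simp only [expi_add, arcCoeff, if_neg hh]
      ring
  · rw [arcMajorant]
    simp only [floorPrimitive_eq]
    push_cast
    field_simp
    ring

/-- Bounds for the Fourier coefficients of `arcMajorant`. -/
def arcWeight (δ : ℝ) (h : ℤ) : ℝ :=
  if h = 0 then 2 else min (1 / |(h : ℝ)|) (1 / (δ * (h : ℝ) ^ 2))

lemma arcWeight_nonneg {δ : ℝ} (hδ : 0 < δ) (h : ℤ) : 0 ≤ arcWeight δ h := by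
  unfold arcWeight
  split_ifs
  · norm_num
  · positivity

/-- Counting four unimodular terms gives the decay 1/(δh²). Pairing the terms whose phases differ by
hδ gains a factor |h|δ and gives 1/|h|. -/
lemma norm_arcCoeff_le {a b δ : ℝ} (hδ : 0 < δ) (hδ1 : δ ≤ 1) (hab : a ≤ b) (hba : b ≤ a + 1)
    (h : ℤ) : ‖arcCoeff a b δ h‖ ≤ arcWeight δ h := by
  unfold arcCoeff arcWeight
  split_ifs with hh
  · rw [Complex.norm_real, Real.norm_eq_abs, abs_le]
    constructor <;> linarith
  have hh' : (0 : ℝ) < |(h : ℝ)| := by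
    rw [abs_pos]
    exact_mod_cast hh
  have hp : (0 : ℝ) < Real.pi := Real.pi_pos
  have hp3 := Real.pi_gt_three
  have key : ∀ T : ℂ, ‖-(1 / (4 * Real.pi ^ 2 * δ) : ℂ) * (1 / (h : ℂ) ^ 2 * T)‖
      = ‖T‖ / (4 * Real.pi ^ 2 * δ * |(h : ℝ)| ^ 2) := by
    intro T
    simp only [norm_mul, norm_neg, norm_div, norm_pow, norm_one, Complex.norm_real,
      Complex.norm_intCast, Real.norm_eq_abs, abs_of_pos hδ, abs_of_pos hp, Complex.norm_ofNat]
    field_simp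
  rw [key]
  have hdiff : ∀ u v : ℝ, ‖expi u - expi v‖ ≤ 2 * Real.pi * |u - v| := by
    intro u v
    have : expi u - expi v = expi v * (expi (u - v) - 1) := by
      rw [mul_sub, ← expi_add, mul_one, add_sub_cancel]
    rw [this, norm_mul, norm_expi, one_mul]
    exact norm_expi_sub_one_le _
  set u1 := expi (h * (δ - a))
  set u2 := expi (h * (-a))
  set u3 := expi (h * (-b))
  set u4 := expi (h * (-b - δ))
  have n1 : ‖u1‖ = 1 := norm_expi _
  have n2 : ‖u2‖ = 1 := norm_expi _
  have n3 : ‖u3‖ = 1 := norm_expi _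
  have n4 : ‖u4‖ = 1 := norm_expi _
  have d1 : ‖u1 - u2‖ ≤ 2 * Real.pi * (|(h : ℝ)| * δ) := by
    refine (hdiff _ _).trans_eq ?_
    rw [← mul_sub, abs_mul]
    congr 3
    rw [sub_neg_eq_add, sub_add_cancel, abs_of_pos hδ]
  have d2 : ‖u4 - u3‖ ≤ 2 * Real.pi * (|(h : ℝ)| * δ) := by
    refine (hdiff _ _).trans_eq ?_
    rw [← mul_sub, abs_mul]
    congr 3
    rw [show -b - δ - -b = -δ by ring, abs_neg, abs_of_pos hδ]
  have t1 : ‖u1 - u2 - u3 + u4‖ ≤ 4 := by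
    have := norm_add_le (u1 - u2 - u3) u4
    have := norm_sub_le (u1 - u2) u3
    have := norm_sub_le u1 u2
    linarith
  have t2 : ‖u1 - u2 - u3 + u4‖ ≤ 4 * Real.pi * (|(h : ℝ)| * δ) := by
    have := norm_add_le (u1 - u2) (u4 - u3)
    rw [show u1 - u2 + (u4 - u3) = u1 - u2 - u3 + u4 by ring] at this
    linarith
  refine le_min ?_ ?_
  · rw [div_le_div_iff₀ (by positivity) hh']
    have : 4 * Real.pi * (|(h : ℝ)| * δ) * |(h : ℝ)| ≤ 4 * Real.pi ^ 2 * δ * |(h : ℝ)| ^ 2 := by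
      have : 0 ≤ 4 * Real.pi * δ * |(h : ℝ)| ^ 2 := by positivity
      nlinarith
    nlinarith
  · rw [div_le_div_iff₀ (by positivity) (by positivity), ← sq_abs (h : ℝ)]
    have h4 : (4 : ℝ) ≤ 4 * Real.pi ^ 2 := by nlinarith
    have : 0 ≤ δ * |(h : ℝ)| ^ 2 := by positivity
    nlinarith

/-! ### An Erdős–Turán type inequality for boxes -/

/-- The product of the majorants is expanded into characters; frequency 0 gives the main term.
Working with symmetric partial sums and a bound uniform in `H` avoids any multiple series. -/
lemma sum_prod_arcIndicator_le {m : ℕ} {σ : Type*} (T : Finset σ) (x : σ → Fin m → ℝ)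
    {a b : Fin m → ℝ} {δ Z : ℝ} (hδ : 0 < δ) (hδ1 : δ ≤ 1) (hab : ∀ j, a j ≤ b j)
    (hba : ∀ j, b j ≤ a j + 1)
    (hZ : ∀ H : ℕ, ∑ h ∈ (Fintype.piFinset fun _ : Fin m => Finset.Icc (-(H : ℤ)) H).erase 0,
      (∏ j, arcWeight δ (h j)) * ‖∑ p ∈ T, expi (∑ j, h j * x p j)‖ ≤ Z) :
    ∑ p ∈ T, ∏ j, arcIndicator (a j) (b j) (x p j) ≤ T.card * ∏ j, (b j - a j + δ) + Z := by
  have hlim : Tendsto (fun H : ℕ => ∑ p ∈ T, ∏ j, ∑ h ∈ Finset.Icc (-(H : ℤ)) H,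
      arcCoeff (a j) (b j) δ h * expi (h * x p j)) atTop
      (𝓝 (∑ p ∈ T, ∏ j, (arcMajorant (a j) (b j) δ (x p j) : ℂ))) := by
    refine tendsto_finsetSum _ fun p _ => tendsto_finsetProd _ fun j _ => ?_
    exact (hasSum_arcMajorant (a j) (b j) hδ (x p j)).comp Finset.tendsto_Icc_neg
  have hbound : ‖(∑ p ∈ T, ∏ j, (arcMajorant (a j) (b j) δ (x p j) : ℂ)) -
      T.card * ∏ j, ((b j - a j + δ : ℝ) : ℂ)‖ ≤ Z := by
    refine le_of_tendsto (hlim.sub_const _).norm (Eventually.of_forall fun H => ?_)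
    refine le_trans ?_ (hZ H)
    have h1 : ∑ p ∈ T, ∏ j, ∑ h ∈ Finset.Icc (-(H : ℤ)) H,
        arcCoeff (a j) (b j) δ h * expi (h * x p j) =
        ∑ h ∈ Fintype.piFinset fun _ : Fin m => Finset.Icc (-(H : ℤ)) H,
          (∏ j, arcCoeff (a j) (b j) δ (h j)) * ∑ p ∈ T, expi (∑ j, h j * x p j) := by
      simp_rw [Finset.prod_univ_sum, Finset.mul_sum]
      rw [Finset.sum_comm]
      refine Finset.sum_congr rfl fun h _ => Finset.sum_congr rfl fun p _ => ?_
      rw [Finset.prod_mul_distrib, expi_finset_sum]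
    have hmem : (0 : Fin m → ℤ) ∈ Fintype.piFinset fun _ : Fin m => Finset.Icc (-(H : ℤ)) H := by
      simp [Fintype.mem_piFinset]
    rw [h1, ← Finset.add_sum_erase _ _ hmem]
    have h2 : (∏ j, arcCoeff (a j) (b j) δ ((0 : Fin m → ℤ) j)) *
        ∑ p ∈ T, expi (∑ j, ((0 : Fin m → ℤ) j : ℝ) * x p j) =
        T.card * ∏ j, ((b j - a j + δ : ℝ) : ℂ) := by
      simp [arcCoeff, expi_zero, mul_comm]
    rw [h2, add_sub_cancel_left]
    refine (norm_sum_le _ _).trans (Finset.sum_le_sum fun h _ => ?_)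
    rw [norm_mul, norm_prod]
    gcongr with j
    exact norm_arcCoeff_le hδ hδ1 (hab j) (hba j) _
  have h3 : ∑ p ∈ T, ∏ j, arcMajorant (a j) (b j) δ (x p j) ≤
      T.card * ∏ j, (b j - a j + δ) + Z := by
    have := (Complex.re_le_norm _).trans hbound
    have h4 : ((∑ p ∈ T, ∏ j, (arcMajorant (a j) (b j) δ (x p j) : ℂ)) -
      T.card * ∏ j, ((b j - a j + δ : ℝ) : ℂ)) =
      ((∑ p ∈ T, ∏ j, arcMajorant (a j) (b j) δ (x p j) - T.card * ∏ j, (b j - a j + δ) : ℝ) : ℂ)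
      := by push_cast; rfl
    rw [h4, Complex.ofReal_re] at this
    linarith
  -- Nonnegativity of the indicators lets majorants be multiplied. Minorants may be negative and
  -- could not be treated this way, so only the upper bound is direct.
  refine le_trans (Finset.sum_le_sum fun p _ => ?_) h3
  exact Finset.prod_le_prod (fun j _ => arcIndicator_nonneg (hab j) _)
    fun j _ => arcIndicator_le_arcMajorant hδ _

lemma prod_add_le {ι : Type*} (s : Finset ι) {v : ι → ℝ} {δ : ℝ} (hδ : 0 ≤ δ) (hδ1 : δ ≤ 1)
    (hv : ∀ i, 0 ≤ v i) (hv1 : ∀ i, v i ≤ 1) :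
    ∏ i ∈ s, (v i + δ) ≤ ∏ i ∈ s, v i + 2 ^ s.card * δ := by
  classical
  -- The constant c = 2^card - 1 satisfies the recursion c ↦ 2c + 1 that the induction produces.
  suffices ∏ i ∈ s, (v i + δ) ≤ ∏ i ∈ s, v i + (2 ^ s.card - 1) * δ by linarith
  induction s using Finset.induction_on with
  | empty => simp
  | insert i s hi ih =>
    rw [Finset.prod_insert hi, Finset.prod_insert hi, Finset.card_insert_of_notMem hi, pow_succ]
    have h1 : ∏ i ∈ s, v i ≤ 1 := Finset.prod_le_one (fun i _ => hv i) fun i _ => hv1 i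
    have h2 : (v i + δ) * ∏ i ∈ s, (v i + δ) ≤
      (v i + δ) * (∏ i ∈ s, v i + (2 ^ s.card - 1) * δ) :=
      mul_le_mul_of_nonneg_left ih (add_nonneg (hv i) hδ)
    have h3 : (1 : ℝ) ≤ 2 ^ s.card := one_le_pow₀ (by norm_num)
    have h4 : (v i + δ) * ((2 ^ s.card - 1) * δ) ≤ 2 * ((2 ^ s.card - 1) * δ) := by
      refine mul_le_mul_of_nonneg_right ?_ (mul_nonneg (by linarith) hδ)
      linarith [hv1 i]
    have h5 : δ * ∏ i ∈ s, v i ≤ δ * 1 := mul_le_mul_of_nonneg_left h1 hδ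
    nlinarith

/-- The discrepancy of a finite family of points of the torus with respect to boxes. -/
lemma abs_sum_prod_arcIndicator_sub_le {m : ℕ} {σ : Type*} (T : Finset σ) (x : σ → Fin m → ℝ)
    {a b : Fin m → ℝ} {δ Z : ℝ} (hδ : 0 < δ) (hδ1 : δ ≤ 1) (hab : ∀ j, a j ≤ b j)
    (hba : ∀ j, b j ≤ a j + 1)
    (hZ : ∀ H : ℕ, ∑ h ∈ (Fintype.piFinset fun _ : Fin m => Finset.Icc (-(H : ℤ)) H).erase 0,
      (∏ j, arcWeight δ (h j)) * ‖∑ p ∈ T, expi (∑ j, h j * x p j)‖ ≤ Z) :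
    |∑ p ∈ T, ∏ j, arcIndicator (a j) (b j) (x p j) - T.card * ∏ j, (b j - a j)| ≤
      2 ^ m * (T.card * (2 ^ m * δ) + Z) := by
  classical
  set err : ℝ := T.card * (2 ^ m * δ) + Z with herr
  have hZ0 : 0 ≤ Z := by
    refine le_trans (Finset.sum_nonneg fun h _ => ?_) (hZ 0)
    exact mul_nonneg (Finset.prod_nonneg fun j _ => arcWeight_nonneg hδ _) (norm_nonneg _)
  have herr0 : 0 ≤ err := by positivity
  have upper : ∀ a b : Fin m → ℝ, (∀ j, a j ≤ b j) → (∀ j, b j ≤ a j + 1) →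
      ∑ p ∈ T, ∏ j, arcIndicator (a j) (b j) (x p j) ≤ T.card * ∏ j, (b j - a j) + err := by
    intro a b hab hba
    have h1 := sum_prod_arcIndicator_le T x hδ hδ1 hab hba hZ
    have h2 := prod_add_le Finset.univ hδ.le hδ1 (v := fun j => b j - a j)
      (fun j => by linarith [hab j]) (fun j => by linarith [hba j])
    rw [Finset.card_univ, Fintype.card_fin] at h2
    have h3 := mul_le_mul_of_nonneg_left h2 (Nat.cast_nonneg (α := ℝ) T.card)
    rw [herr]
    linarith
  -- Choosing in each coordinate the arc or its complement cuts the torus into 2^m boxes, to all of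
  -- which the upper bound applies.
  let a' : Finset (Fin m) → Fin m → ℝ := fun S j => if j ∈ S then a j else b j
  let b' : Finset (Fin m) → Fin m → ℝ := fun S j => if j ∈ S then b j else a j + 1
  have hsplit : ∀ f : Fin m → ℝ, ∑ S ∈ (Finset.univ : Finset (Fin m)).powerset,
      ∏ j, (if j ∈ S then f j else 1 - f j) = 1 := by
    intro f
    have h := Finset.prod_add f (fun j => 1 - f j) Finset.univ
    simp only [add_sub_cancel, Finset.prod_const_one] at h
    refine Eq.trans ?_ h.symm
    refine Finset.sum_congr rfl fun S hS => ?_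
    rw [Finset.prod_ite]
    congr 1
    · congr 1
      ext; simp
    · congr 1
      ext; simp
  have hcount : ∑ S ∈ (Finset.univ : Finset (Fin m)).powerset,
      ∑ p ∈ T, ∏ j, arcIndicator (a' S j) (b' S j) (x p j) = T.card := by
    rw [Finset.sum_comm]
    have : ∀ p ∈ T, ∑ S ∈ (Finset.univ : Finset (Fin m)).powerset,
        ∏ j, arcIndicator (a' S j) (b' S j) (x p j) = 1 := by
      intro p _
      rw [← hsplit fun j => arcIndicator (a j) (b j) (x p j)]
      refine Finset.sum_congr rfl fun S _ => Finset.prod_congr rfl fun j _ => ?_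
      simp only [a', b']
      split_ifs
      · rfl
      · rw [one_sub_arcIndicator]
    rw [Finset.sum_congr rfl this]
    simp
  have hvol : ∑ S ∈ (Finset.univ : Finset (Fin m)).powerset,
      T.card * ∏ j, (b' S j - a' S j) = (T.card : ℝ) := by
    rw [← Finset.mul_sum]
    have : ∑ S ∈ (Finset.univ : Finset (Fin m)).powerset, ∏ j, (b' S j - a' S j) = 1 := by
      rw [← hsplit fun j => b j - a j]
      refine Finset.sum_congr rfl fun S _ => Finset.prod_congr rfl fun j _ => ?_
      simp only [a', b']
      split_ifs
      · rfl
      · ring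
    rw [this, mul_one]
  have hself : ∀ j, a' Finset.univ j = a j ∧ b' Finset.univ j = b j := by simp [a', b']
  have hmem : Finset.univ ∈ (Finset.univ : Finset (Fin m)).powerset := by simp
  have hone : (1 : ℝ) ≤ 2 ^ m := one_le_pow₀ (by norm_num)
  rw [abs_le]
  constructor
  -- Lower bound: the given box holds whatever the other 2^m - 1 boxes do not, and these have upper
  -- bounds.
  · rw [← Finset.add_sum_erase _ _ hmem] at hcount hvol
    have hother : ∑ S ∈ (Finset.univ : Finset (Fin m)).powerset.erase Finset.univ,
        ∑ p ∈ T, ∏ j, arcIndicator (a' S j) (b' S j) (x p j) ≤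
        ∑ S ∈ (Finset.univ : Finset (Fin m)).powerset.erase Finset.univ,
          (T.card * ∏ j, (b' S j - a' S j) + err) := by
      refine Finset.sum_le_sum fun S _ => upper _ _ ?_ ?_
      · intro j
        simp only [a', b']
        split_ifs
        · exact hab j
        · exact hba j
      · intro j
        simp only [a', b']
        split_ifs
        · exact hba j
        · linarith [hab j]
    rw [Finset.sum_add_distrib, Finset.sum_const, Finset.card_erase_of_mem hmem,
      Finset.card_powerset, Finset.card_univ, Fintype.card_fin, nsmul_eq_mul,
      Nat.cast_sub Nat.one_le_two_pow] at hother
    simp only [hself] at hcount hvol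
    push_cast at hother
    nlinarith
  · have := upper a b hab hba
    nlinarith

/-! ### Geometric sums and peaks -/

/-- The distance to the nearest integer. -/
def distInt (θ : ℝ) : ℝ := min (Int.fract θ) (1 - Int.fract θ)

lemma distInt_nonneg (θ : ℝ) : 0 ≤ distInt θ :=
  le_min (Int.fract_nonneg θ) (sub_nonneg.2 (Int.fract_lt_one θ).le)

lemma four_mul_distInt_le (θ : ℝ) : 4 * distInt θ ≤ ‖expi θ - 1‖ := by
  have h1 : distInt θ = |θ - round θ| := (abs_sub_round_eq_min θ).symm
  have h2 : expi θ = expi (θ - round θ) := by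
    conv_lhs => rw [← sub_add_cancel θ (round θ : ℝ), expi_add, expi_intCast, mul_one]
  rw [h1, h2, norm_expi_sub_one]
  have hp := Real.pi_pos
  have h3 : |Real.pi * (θ - round θ)| ≤ Real.pi / 2 := by
    rw [abs_mul, abs_of_pos hp]
    nlinarith [abs_sub_round θ]
  have h4 := Real.mul_abs_le_abs_sin h3
  rw [abs_mul, abs_of_pos hp] at h4
  have : 2 / Real.pi * (Real.pi * |θ - round θ|) = 2 * |θ - round θ| := by field_simp
  linarith

/-- A smoothed form of `min M ‖θ‖⁻¹`, where `‖θ‖` is the distance to the nearest integer. -/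
def peak (M θ : ℝ) : ℝ := M / (1 + M * distInt θ)

lemma peak_nonneg {M : ℝ} (hM : 0 ≤ M) (θ : ℝ) : 0 ≤ peak M θ :=
  div_nonneg hM (by have := mul_nonneg hM (distInt_nonneg θ); linarith)

lemma peak_le {M : ℝ} (hM : 0 ≤ M) (θ : ℝ) : peak M θ ≤ M :=
  div_le_self hM (by have := mul_nonneg hM (distInt_nonneg θ); linarith)

lemma peak_periodic (M : ℝ) : Function.Periodic (peak M) 1 := by
  intro θ
  simp [peak, distInt]

lemma measurable_peak (M : ℝ) : Measurable (peak M) := by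
  have : Measurable distInt := measurable_fract.min (measurable_const.sub measurable_fract)
  exact measurable_const.div (measurable_const.add (measurable_const.mul this))

lemma intervalIntegrable_peak {M : ℝ} (hM : 0 ≤ M) (a b : ℝ) :
    IntervalIntegrable (peak M) volume a b := by
  rw [intervalIntegrable_iff, IntegrableOn, Set.uIoc]
  refine Integrable.of_bound (measurable_peak M).aestronglyMeasurable M (ae_of_all _ fun θ => ?_)
  rw [Real.norm_eq_abs, abs_of_nonneg (peak_nonneg hM θ)]
  exact peak_le hM θ

lemma sum_Icc_int_eq (N : ℕ) (p : ℤ) (f : ℤ → ℂ) :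
    ∑ n ∈ Finset.Icc (p - N) (p + N), f n = ∑ i ∈ Finset.range (2 * N + 1), f (p - N + i) := by
  refine Finset.sum_bij' (fun n _ => (n - (p - N)).toNat) (fun i _ => p - N + i) ?_ ?_ ?_ ?_ ?_
  · intro n hn
    simp only [Finset.mem_Icc, Finset.mem_range] at *
    omega
  · intro n hn
    simp only [Finset.mem_Icc, Finset.mem_range] at *
    omega
  · intro n hn
    simp only [Finset.mem_Icc] at *
    omega
  · intro n hn
    simp
  · intro n hn
    simp only [Finset.mem_Icc] at hn
    congr 1
    omega

/-- Combines the trivial bound 2N + 1 with the geometric series bound. Allowing any `M` above `N` is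
what later permits control along sparse scales only. -/
lemma norm_sum_expi_le {M : ℝ} {N : ℕ} (hN : 1 ≤ N) (hM : N ≤ M) (p : ℤ) (θ : ℝ) :
    ‖∑ n ∈ Finset.Icc (p - N) (p + N), expi (n * θ)‖ ≤ 6 * peak M θ := by
  have hN' : (1 : ℝ) ≤ N := by exact_mod_cast hN
  set S := ∑ n ∈ Finset.Icc (p - N) (p + N), expi (n * θ) with hS
  have hgeom : S = expi ((p - N : ℤ) * θ) * ∑ i ∈ Finset.range (2 * N + 1), expi θ ^ i := by
    rw [hS, sum_Icc_int_eq N p fun n => expi (n * θ), Finset.mul_sum]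
    refine Finset.sum_congr rfl fun i _ => ?_
    have h1 : expi θ ^ i = expi (i * θ) := by
      rw [expi, expi, ← Complex.exp_nat_mul]
      congr 1
      push_cast
      ring
    rw [h1, ← expi_add]
    congr 1
    push_cast
    ring
  have h1 : ‖S‖ ≤ 2 * N + 1 := by
    rw [hgeom, norm_mul, norm_expi, one_mul]
    refine (norm_sum_le _ _).trans ?_
    simp [norm_pow, norm_expi]
  have h2 : ‖S‖ * ‖expi θ - 1‖ ≤ 2 := by
    rw [← norm_mul, hgeom, mul_assoc, geom_sum_mul, norm_mul, norm_expi, one_mul]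
    refine (norm_sub_le _ _).trans ?_
    rw [norm_pow, norm_expi]
    norm_num
  have h3 : ‖S‖ * (4 * distInt θ) ≤ 2 :=
    (mul_le_mul_of_nonneg_left (four_mul_distInt_le θ) (norm_nonneg _)).trans h2
  have hd := distInt_nonneg θ
  have hM0 : 0 < M := by linarith
  rw [peak, mul_div_assoc', le_div_iff₀ (by positivity)]
  nlinarith

/-! ### Averages over the coefficients -/

lemma integral_peak_le {M : ℝ} (hM : 0 < M) :
    ∫ θ in (0 : ℝ)..1, peak M θ ≤ 2 * Real.log (1 + M) := by
  have h1 : ∫ θ in (0 : ℝ)..1, M / (1 + M * θ) = Real.log (1 + M) := by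
    have := intervalIntegral.integral_comp_mul_add (a := 0) (b := 1) (fun x : ℝ => 1 / x) hM.ne' 1
    rw [integral_one_div_of_pos (by norm_num) (by linarith)] at this
    simp only [mul_zero, zero_add, mul_one, div_one] at this
    have h2 : (fun θ : ℝ => M / (1 + M * θ)) = fun θ => M * (1 / (M * θ + 1)) := by
      ext θ
      rw [mul_one_div, add_comm]
    rw [h2, intervalIntegral.integral_const_mul, this, smul_eq_mul, mul_inv_cancel_left₀ hM.ne',
      add_comm]
  have h2 : ∫ θ in (0 : ℝ)..1, M / (1 + M * (1 - θ)) = Real.log (1 + M) := by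
    have := intervalIntegral.integral_comp_sub_left (a := 0) (b := 1)
      (fun θ : ℝ => M / (1 + M * θ)) 1
    rw [this, sub_self, sub_zero, h1]
  have c1 : IntervalIntegrable (fun θ => M / (1 + M * θ)) volume 0 1 := by
    refine ContinuousOn.intervalIntegrable (ContinuousOn.div (by fun_prop) (by fun_prop) ?_)
    intro θ hθ
    rw [Set.uIcc_of_le zero_le_one] at hθ
    have := mul_nonneg hM.le hθ.1
    linarith
  have c2 : IntervalIntegrable (fun θ => M / (1 + M * (1 - θ))) volume 0 1 := by
    refine ContinuousOn.intervalIntegrable (ContinuousOn.div (by fun_prop) (by fun_prop) ?_)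
    intro θ hθ
    rw [Set.uIcc_of_le zero_le_one] at hθ
    have := mul_nonneg hM.le (sub_nonneg.2 hθ.2)
    linarith
  have h3 : ∫ θ in (0 : ℝ)..1, peak M θ ≤
      ∫ θ in (0 : ℝ)..1, (M / (1 + M * θ) + M / (1 + M * (1 - θ))) := by
    have hmono : ∀ θ ∈ Set.Ioo (0 : ℝ) 1, peak M θ ≤
        M / (1 + M * θ) + M / (1 + M * (1 - θ)) := by
      intro θ hθ
      have hf : Int.fract θ = θ := Int.fract_eq_self.2 ⟨hθ.1.le, hθ.2⟩
      have e1 : 0 < 1 + M * θ := by have := mul_pos hM hθ.1; linarith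
      have e2 : 0 < 1 + M * (1 - θ) := by have := mul_pos hM (sub_pos.2 hθ.2); linarith
      have p1 := div_pos hM e1
      have p2 := div_pos hM e2
      rw [peak, distInt, hf]
      rcases min_choice θ (1 - θ) with h | h <;> rw [h] <;> linarith
    refine intervalIntegral.integral_mono_on_of_le_Ioo zero_le_one ?_ (c1.add c2) hmono
    exact intervalIntegrable_peak hM.le 0 1
  rw [intervalIntegral.integral_add c1 c2, h1, h2] at h3
  linarith

/-- The argument runs through exactly 2K|h| periods, and the substitution divides by |h|, so the
bound does not depend on `h` or `c`. -/
lemma integral_peak_comp_le {M : ℝ} (hM : 0 < M) (K : ℕ) {h : ℤ} (hh : h ≠ 0) (c : ℝ) :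
    ∫ x in Set.Icc (-K : ℝ) K, peak M (h * x + c) ≤ 4 * K * Real.log (1 + M) := by
  have hK : (-K : ℝ) ≤ K := by have := Nat.cast_nonneg (α := ℝ) K; linarith
  have hh' : (h : ℝ) ≠ 0 := by exact_mod_cast hh
  rw [integral_Icc_eq_integral_Ioc, ← intervalIntegral.integral_of_le hK,
    intervalIntegral.integral_comp_mul_add (peak M) hh' c]
  have e : (h : ℝ) * K + c = (h * (-K) + c) + (2 * K * h : ℤ) • (1 : ℝ) := by
    rw [zsmul_eq_mul]
    push_cast
    ring
  rw [e, (peak_periodic M).intervalIntegral_add_zsmul_eq _ _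
      fun _ _ => intervalIntegrable_peak hM.le _ _,
    (peak_periodic M).intervalIntegral_add_eq _ 0, zero_add, smul_eq_mul, zsmul_eq_mul]
  have h1 := integral_peak_le hM
  have : (h : ℝ)⁻¹ * (((2 * K * h : ℤ) : ℝ) * ∫ x in (0 : ℝ)..1, peak M x)
      = 2 * K * ∫ x in (0 : ℝ)..1, peak M x := by
    push_cast
    field_simp
  rw [this]
  have := mul_le_mul_of_nonneg_left h1 (by positivity : (0 : ℝ) ≤ 2 * K)
  linarith

/-- Lebesgue measure on the cube `[-K, K]ᵈ`. -/
abbrev cubeMeasure (d K : ℕ) : Measure (Fin d → ℝ) :=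
  Measure.pi fun _ => (volume : Measure ℝ).restrict (Set.Icc (-K : ℝ) K)

lemma lintegral_prod_peak_le {M : ℝ} (hM : 0 < M) (d K : ℕ) {h : ℤ} (hh : h ≠ 0) (c : Fin d → ℝ) :
    ∫⁻ x, ENNReal.ofReal (∏ i, peak M (h * x i + c i)) ∂cubeMeasure d K ≤
      ENNReal.ofReal ((4 * K * Real.log (1 + M)) ^ d) := by
  have hint : ∀ i, Integrable (fun x : ℝ => peak M (h * x + c i))
      (volume.restrict (Set.Icc (-K : ℝ) K)) := fun i => by
    refine Integrable.of_bound ?_ M (ae_of_all _ fun θ => ?_)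
    · exact ((measurable_peak M).comp (by fun_prop)).aestronglyMeasurable
    · rw [Real.norm_eq_abs, abs_of_nonneg (peak_nonneg hM.le _)]
      exact peak_le hM.le _
  rw [← ofReal_integral_eq_lintegral_ofReal]
  · refine ENNReal.ofReal_le_ofReal ?_
    rw [integral_fintype_prod_eq_prod (fun i (x : ℝ) => peak M (h * x + c i))]
    refine (Finset.prod_le_prod (fun i _ => integral_nonneg fun x => peak_nonneg hM.le _)
      fun i _ => integral_peak_comp_le hM K hh (c i)).trans_eq ?_
    simp
  · exact Integrable.fintype_prod hint
  · exact ae_of_all _ fun x => Finset.prod_nonneg fun i _ => peak_nonneg hM.le _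

lemma lintegral_pi_le_of_insertNth {X : Type*} [MeasurableSpace X] (ν : Measure X) [SigmaFinite ν]
    {m : ℕ} (j₀ : Fin (m + 1)) {f : (Fin (m + 1) → X) → ENNReal} (hf : Measurable f) {c : ENNReal}
    (hc : ∀ v : Fin m → X, ∫⁻ u, f (j₀.insertNth u v) ∂ν ≤ c) :
    ∫⁻ α, f α ∂(Measure.pi fun _ => ν) ≤ c * (Measure.pi fun _ : Fin m => ν) Set.univ := by
  have hmp := (measurePreserving_piFinSuccAbove (fun _ : Fin (m + 1) => ν) j₀).symm
  rw [← hmp.lintegral_comp_emb (MeasurableEquiv.measurableEmbedding _), lintegral_prod_symm']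
  · rw [← lintegral_const]
    exact lintegral_mono hc
  · exact hf.comp (MeasurableEquiv.measurable _)

lemma measurable_prod_peak_linearForm (M : ℝ) {m d : ℕ} (h : Fin m → ℤ) :
    Measurable fun α : Fin m → Fin d → ℝ =>
      ENNReal.ofReal (∏ i, peak M (∑ j, h j * α j i)) := by
  refine ENNReal.measurable_ofReal.comp (Finset.measurable_prod _ fun i _ => ?_)
  refine (measurable_peak M).comp (Finset.measurable_sum _ fun j _ => ?_)
  exact measurable_const.mul ((measurable_pi_apply i).comp (measurable_pi_apply j))

/-- Choose a row j₀ with h j₀ ≠ 0 and freeze the others. The d linear forms then involve separate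
variables, each with the nonzero integer slope h j₀, and the integral factors. -/
lemma lintegral_prod_peak_linearForm_le {M : ℝ} (hM : 0 < M) (m d K : ℕ) {h : Fin m → ℤ}
    (hh : h ≠ 0) :
    ∫⁻ α, ENNReal.ofReal (∏ i : Fin d, peak M (∑ j, h j * α j i))
        ∂(Measure.pi fun _ : Fin m => cubeMeasure d K) ≤
      ENNReal.ofReal ((4 * K * Real.log (1 + M)) ^ d) *
        (Measure.pi fun _ : Fin (m - 1) => cubeMeasure d K) Set.univ := by
  obtain ⟨j₀, hj₀⟩ := Function.ne_iff.1 hh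
  obtain _ | m := m
  · exact j₀.elim0
  refine lintegral_pi_le_of_insertNth _ j₀ (measurable_prod_peak_linearForm M h) fun v => ?_
  refine le_trans (lintegral_mono fun u => le_of_eq ?_) (lintegral_prod_peak_le hM d K hj₀
    fun i => ∑ j, h (j₀.succAbove j) * v j i)
  congr 1
  refine Finset.prod_congr rfl fun i _ => ?_
  rw [Fin.sum_univ_succAbove _ j₀]
  simp

lemma arcWeight_neg (δ : ℝ) (h : ℤ) : arcWeight δ (-h) = arcWeight δ h := by
  simp [arcWeight]

/-- The sum is cut at |h| = D: a harmonic sum below, and above it D times a tail of ∑ 1/h², which is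
bounded. -/
lemma sum_arcWeight_le {D : ℕ} (hD : 1 ≤ D) (H : ℕ) :
    ∑ h ∈ Finset.Icc (-(H : ℤ)) H, arcWeight (1 / D) h ≤ 8 + 2 * Real.log D := by
  have hD' : (1 : ℝ) ≤ D := by exact_mod_cast hD
  have h1 : ∑ h ∈ Finset.Icc (-(H : ℤ)) H, arcWeight (1 / D) h =
      2 + 2 * ∑ h ∈ Finset.Icc 1 H, arcWeight (1 / D) h := by
    induction H with
    | zero => simp [arcWeight]
    | succ H ih =>
      have e : Finset.Icc (-((H + 1 : ℕ) : ℤ)) (H + 1 : ℕ) =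
          insert (-((H + 1 : ℕ) : ℤ)) (insert ((H + 1 : ℕ) : ℤ) (Finset.Icc (-(H : ℤ)) H)) := by
        ext x
        simp only [Finset.mem_Icc, Finset.mem_insert]
        omega
      rw [e, Finset.sum_insert, Finset.sum_insert, ih, Finset.sum_Icc_succ_top (by omega),
        arcWeight_neg]
      · push_cast
        ring
      · simp
      · simp only [Finset.mem_insert, Finset.mem_Icc]
        omega
  have h2 : ∀ h ∈ Finset.Icc 1 H, arcWeight (1 / D) (h : ℤ) ≤
      (if h ≤ D then (h : ℝ)⁻¹ else 0) + (if D < h then D * ((h : ℝ) ^ 2)⁻¹ else 0) := by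
    intro h hh
    have hh1 : 1 ≤ h := (Finset.mem_Icc.1 hh).1
    have hne : (h : ℤ) ≠ 0 := by omega
    rw [arcWeight, if_neg hne]
    by_cases hle : h ≤ D
    · rw [if_pos hle, if_neg (by omega), add_zero]
      refine (min_le_left _ _).trans_eq ?_
      simp
    · rw [if_neg hle, if_pos (by omega), zero_add]
      refine (min_le_right _ _).trans_eq ?_
      field_simp
      simp
  have h3 : ∑ h ∈ Finset.Icc 1 H, (if h ≤ D then (h : ℝ)⁻¹ else 0) ≤ 1 + Real.log D := by
    refine le_trans ?_ (harmonic_le_one_add_log D)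
    rw [harmonic_eq_sum_Icc, ← Finset.sum_filter]
    push_cast
    refine Finset.sum_le_sum_of_subset_of_nonneg ?_ fun _ _ _ => by positivity
    intro x hx
    simp only [Finset.mem_filter, Finset.mem_Icc] at *
    omega
  have h4 : ∑ h ∈ Finset.Icc 1 H, (if D < h then D * ((h : ℝ) ^ 2)⁻¹ else 0) ≤ 2 := by
    have h5 : ∑ h ∈ Finset.Icc 1 H, (if D < h then D * ((h : ℝ) ^ 2)⁻¹ else 0) ≤
        D * ∑ h ∈ Finset.Ioo D (H + 1), ((h : ℝ) ^ 2)⁻¹ := by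
      rw [← Finset.sum_filter, ← Finset.mul_sum]
      gcongr
      intro x hx
      simp only [Finset.mem_filter, Finset.mem_Icc, Finset.mem_Ioo] at *
      omega
    refine h5.trans ?_
    have h6 := mul_le_mul_of_nonneg_left (sum_Ioo_inv_sq_le (α := ℝ) D (H + 1))
      (Nat.cast_nonneg (α := ℝ) D)
    refine h6.trans ?_
    rw [mul_div_assoc', div_le_iff₀ (by positivity)]
    linarith
  have h7 := Finset.sum_le_sum h2
  rw [Finset.sum_add_distrib] at h7
  rw [h1]
  linarith

lemma tsum_prod_arcWeight_le {D : ℕ} (hD : 1 ≤ D) (m : ℕ) :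
    ∑' h : Fin m → ℤ, ENNReal.ofReal (∏ j, arcWeight (1 / D) (h j)) ≤
      ENNReal.ofReal ((8 + 2 * Real.log D) ^ m) := by
  have hD' : (0 : ℝ) < 1 / D := by positivity
  refine ENNReal.summable.tsum_le_of_sum_le fun s => ?_
  have hbox : ∃ H : ℕ, s ⊆ Fintype.piFinset fun _ : Fin m => Finset.Icc (-(H : ℤ)) H := by
    refine ⟨∑ h ∈ s, ∑ j, (h j).natAbs, fun h hh => ?_⟩
    rw [Fintype.mem_piFinset]
    intro j
    have h1 : (h j).natAbs ≤ ∑ j, (h j).natAbs :=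
      Finset.single_le_sum (f := fun j => (h j).natAbs) (fun _ _ => Nat.zero_le _)
        (Finset.mem_univ j)
    have h2 : ∑ j, (h j).natAbs ≤ ∑ h ∈ s, ∑ j, (h j).natAbs :=
      Finset.single_le_sum (f := fun h : Fin m → ℤ => ∑ j, (h j).natAbs)
        (fun _ _ => Nat.zero_le _) hh
    rw [Finset.mem_Icc]
    omega
  obtain ⟨H, hH⟩ := hbox
  have hnn : ∀ h : Fin m → ℤ, 0 ≤ ∏ j, arcWeight (1 / D) (h j) := fun h =>
    Finset.prod_nonneg fun j _ => arcWeight_nonneg hD' _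
  rw [← ENNReal.ofReal_sum_of_nonneg fun h _ => hnn h]
  refine ENNReal.ofReal_le_ofReal ?_
  refine (Finset.sum_le_sum_of_subset_of_nonneg hH fun h _ _ => hnn h).trans ?_
  rw [← Finset.prod_univ_sum]
  refine (Finset.prod_le_prod (fun j _ => Finset.sum_nonneg fun _ _ => arcWeight_nonneg hD' _)
    fun j _ => sum_arcWeight_le hD H).trans_eq ?_
  simp

/-- The weighted sum of exponential sum bounds which controls the discrepancy with respect to boxes
of the values of the linear forms with coefficients `α`. -/
def weightedPeakSum {m d : ℕ} (δ M : ℝ) (α : Fin m → Fin d → ℝ) : ENNReal :=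
  ∑' h : Fin m → ℤ, if h = 0 then 0 else
    ENNReal.ofReal (∏ j, arcWeight δ (h j)) * ENNReal.ofReal (∏ i, peak M (∑ j, h j * α j i))

lemma measurable_weightedPeakSum {m d : ℕ} (δ M : ℝ) :
    Measurable (weightedPeakSum (m := m) (d := d) δ M) := by
  refine Measurable.tsum fun h => ?_
  split_ifs
  · exact measurable_const
  · exact measurable_const.mul (measurable_prod_peak_linearForm M h)

/-- Since the mean of the peaks is bounded uniformly in h ≠ 0, it factors out of the sum: m
logarithms come from the weights and d from the peaks. -/
lemma lintegral_weightedPeakSum_le {M : ℝ} (hM : 0 < M) {D : ℕ} (hD : 1 ≤ D) (m d K : ℕ) :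
    ∫⁻ α, weightedPeakSum (1 / D) M α ∂(Measure.pi fun _ : Fin m => cubeMeasure d K) ≤
      ENNReal.ofReal ((8 + 2 * Real.log D) ^ m) *
      (ENNReal.ofReal ((4 * K * Real.log (1 + M)) ^ d) *
        (Measure.pi fun _ : Fin (m - 1) => cubeMeasure d K) Set.univ) := by
  unfold weightedPeakSum
  rw [lintegral_tsum]
  · refine le_trans ?_ (mul_le_mul_left (tsum_prod_arcWeight_le hD m) _)
    rw [← ENNReal.tsum_mul_right]
    refine ENNReal.tsum_le_tsum fun h => ?_
    by_cases hh : h = 0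
    · simp [hh]
    simp only [if_neg hh]
    rw [lintegral_const_mul _ (measurable_prod_peak_linearForm M h)]
    gcongr
    exact lintegral_prod_peak_linearForm_le hM m d K hh
  · intro h
    by_cases hh : h = 0
    · simp [hh]
    · simp only [if_neg hh]
      exact (measurable_const.mul (measurable_prod_peak_linearForm M h)).aemeasurable

lemma distInt_neg (θ : ℝ) : distInt (-θ) = distInt θ := by
  by_cases h : Int.fract θ = 0
  · rw [distInt, distInt, h, Int.fract_neg_eq_zero.2 h]
  · rw [distInt, distInt, Int.fract_neg h, sub_sub_cancel, min_comm]

lemma peak_neg (M θ : ℝ) : peak M (-θ) = peak M θ := by rw [peak, peak, distInt_neg]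

/-! ### Linear forms at the integer points of a cube -/

/-- The integer points of the cube with centre `p` and side `2N`. -/
def intBox {d : ℕ} (p : Fin d → ℤ) (N : ℕ) : Finset (Fin d → ℤ) :=
  Fintype.piFinset fun i => Finset.Icc (p i - N) (p i + N)

lemma card_intBox {d : ℕ} (p : Fin d → ℤ) (N : ℕ) : (intBox p N).card = (2 * N + 1) ^ d := by
  rw [intBox, Fintype.card_piFinset]
  have : ∀ i, (Finset.Icc (p i - N) (p i + N)).card = 2 * N + 1 := by
    intro i
    rw [Int.card_Icc]
    omega
  simp [this]

lemma norm_sum_expi_linearForm_le {M : ℝ} {N : ℕ} (hN : 1 ≤ N) (hM : N ≤ M) {d m : ℕ}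
    (α : Fin m → Fin d → ℝ) (p : Fin d → ℤ) (t : Fin m → ℝ) (h : Fin m → ℤ) :
    ‖∑ q ∈ intBox p N, expi (∑ j, h j * (t j - ∑ i, α j i * q i))‖ ≤
      6 ^ d * ∏ i, peak M (∑ j, h j * α j i) := by
  have key : ∀ q : Fin d → ℤ, expi (∑ j, h j * (t j - ∑ i, α j i * q i)) =
      expi (∑ j, h j * t j) * ∏ i, expi (q i * -(∑ j, h j * α j i)) := by
    intro q
    rw [← expi_finset_sum, ← expi_add]
    congr 1
    simp only [mul_sub, Finset.sum_sub_distrib, Finset.mul_sum, mul_neg, Finset.sum_neg_distrib]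
    rw [Finset.sum_comm, ← sub_eq_add_neg]
    congr 1
    refine Finset.sum_congr rfl fun i _ => Finset.sum_congr rfl fun j _ => ?_
    ring
  simp_rw [key]
  rw [← Finset.mul_sum, norm_mul, norm_expi, one_mul, intBox,
    ← Finset.prod_univ_sum (fun i => Finset.Icc (p i - N) (p i + N))
      fun i n => expi (n * -(∑ j, h j * α j i)), norm_prod]
  refine (Finset.prod_le_prod (fun i _ => norm_nonneg _)
    fun i _ => norm_sum_expi_le hN hM _ _).trans_eq ?_
  simp [Finset.prod_mul_distrib, peak_neg]

lemma abs_boxCount_sub_le {M B : ℝ} {N : ℕ} (hN : 1 ≤ N) (hM : N ≤ M) {d m : ℕ}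
    {α : Fin m → Fin d → ℝ} (p : Fin d → ℤ) (t : Fin m → ℝ) {a b : Fin m → ℝ}
    (hab : ∀ j, a j ≤ b j) (hba : ∀ j, b j ≤ a j + 1) {δ : ℝ} (hδ : 0 < δ) (hδ1 : δ ≤ 1)
    (hB : 0 ≤ B) (hW : weightedPeakSum δ M α ≤ ENNReal.ofReal B) :
    |∑ q ∈ intBox p N, ∏ j, arcIndicator (a j) (b j) (t j - ∑ i, α j i * q i) -
        (2 * N + 1) ^ d * ∏ j, (b j - a j)| ≤
      2 ^ m * ((2 * N + 1) ^ d * (2 ^ m * δ) + 6 ^ d * B) := by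
  have hM0 : 0 ≤ M := (Nat.cast_nonneg N).trans hM
  have h := abs_sum_prod_arcIndicator_sub_le (intBox p N) (fun q j => t j - ∑ i, α j i * q i)
    hδ hδ1 hab hba (Z := 6 ^ d * B) ?_
  · rw [card_intBox] at h
    push_cast at h
    exact h
  intro H
  set S := (Fintype.piFinset fun _ : Fin m => Finset.Icc (-(H : ℤ)) H).erase 0
  have hw : ∀ h : Fin m → ℤ, 0 ≤ ∏ j, arcWeight δ (h j) := fun h =>
    Finset.prod_nonneg fun j _ => arcWeight_nonneg hδ _
  have hp : ∀ h : Fin m → ℤ, 0 ≤ ∏ i, peak M (∑ j, h j * α j i) := fun h =>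
    Finset.prod_nonneg fun i _ => peak_nonneg hM0 _
  have h1 : ∑ h ∈ S, (∏ j, arcWeight δ (h j)) * ∏ i, peak M (∑ j, h j * α j i) ≤ B := by
    rw [← ENNReal.ofReal_le_ofReal_iff hB,
      ENNReal.ofReal_sum_of_nonneg fun h _ => mul_nonneg (hw h) (hp h)]
    refine le_trans (le_of_eq ?_) ((ENNReal.sum_le_tsum S).trans hW)
    refine Finset.sum_congr rfl fun h hh => ?_
    rw [if_neg (Finset.ne_of_mem_erase hh), ENNReal.ofReal_mul (hw h)]
  refine le_trans ?_ (mul_le_mul_of_nonneg_left h1 (by positivity : (0 : ℝ) ≤ 6 ^ d))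
  rw [Finset.mul_sum]
  refine Finset.sum_le_sum fun h _ => ?_
  refine (mul_le_mul_of_nonneg_left (norm_sum_expi_linearForm_le hN hM α p t h) (hw h)).trans_eq ?_
  ring

/-! ### Almost sure bounds along doubly exponential scales -/

/-- The side lengths `2 ^ 2 ^ i` along which the discrepancy is controlled. -/
def scale (i : ℕ) : ℕ := 2 ^ 2 ^ i

lemma one_le_scale (i : ℕ) : 1 ≤ scale i := Nat.one_le_two_pow

lemma log_scale (i : ℕ) : Real.log (scale i) = 2 ^ i * Real.log 2 := by
  rw [scale]
  push_cast
  rw [Real.log_pow]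
  push_cast
  rfl

lemma log_scale_le (i : ℕ) : Real.log (scale i) ≤ 2 ^ i := by
  rw [log_scale]
  have := Real.log_two_lt_d9
  exact mul_le_of_le_one_right (by positivity) (by linarith)

lemma exists_le_scale {N : ℕ} (hN : 2 ≤ N) : ∃ i, N ≤ scale i ∧ (2 : ℝ) ^ i ≤ 4 * Real.log N := by
  have hl2 := Real.log_two_gt_d9
  have hex : ∃ i, N ≤ scale i := by
    refine ⟨N, ?_⟩
    exact (Nat.lt_two_pow_self.trans (Nat.pow_lt_pow_right (by norm_num) Nat.lt_two_pow_self)).le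
  classical
  refine ⟨Nat.find hex, Nat.find_spec hex, ?_⟩
  -- For the least admissible index, the preceding scale is below `N`; the constant 4 absorbs 2 /
  -- log 2.
  rcases hi : Nat.find hex with _ | i
  · have : Real.log 2 ≤ Real.log N := Real.log_le_log (by norm_num) (by exact_mod_cast hN)
    rw [pow_zero]
    linarith
  · have h1 : ¬ N ≤ scale i := Nat.find_min hex (by omega)
    have h2 : Real.log (scale i) ≤ Real.log N :=
      Real.log_le_log (by exact_mod_cast one_le_scale i) (by exact_mod_cast (not_le.1 h1).le)
    rw [log_scale] at h2
    have h3 : (0 : ℝ) < 2 ^ i := by positivity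
    rw [pow_succ]
    nlinarith

lemma lintegral_weightedPeakSum_scale_le (m d K : ℕ) : ∃ C : ENNReal, C ≠ ⊤ ∧ ∀ i : ℕ,
    ∫⁻ α, weightedPeakSum (1 / ((scale i ^ d : ℕ) : ℝ)) (scale i) α
      ∂(Measure.pi fun _ : Fin m => cubeMeasure d K) ≤
      C * ENNReal.ofReal (((2 : ℝ) ^ i) ^ (d + m)) := by
  refine ⟨ENNReal.ofReal ((8 + 2 * d) ^ m * (8 * K) ^ d) *
    (Measure.pi fun _ : Fin (m - 1) => cubeMeasure d K) Set.univ,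
    ENNReal.mul_ne_top ENNReal.ofReal_ne_top (measure_ne_top _ _), fun i => ?_⟩
  have hs : (1 : ℝ) ≤ scale i := by exact_mod_cast one_le_scale i
  have h2i : (1 : ℝ) ≤ 2 ^ i := one_le_pow₀ (by norm_num)
  have hl := log_scale_le i
  have hl0 : 0 ≤ Real.log (scale i) := Real.log_nonneg hs
  refine (lintegral_weightedPeakSum_le (by linarith) (Nat.one_le_pow _ _ (one_le_scale i))
    m d K).trans ?_
  have h1 : (8 + 2 * Real.log ((scale i ^ d : ℕ) : ℝ)) ≤ (8 + 2 * d) * 2 ^ i := by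
    push_cast
    rw [Real.log_pow]
    have := mul_le_mul_of_nonneg_left hl (Nat.cast_nonneg (α := ℝ) d)
    nlinarith
  have h1' : 0 ≤ 8 + 2 * Real.log ((scale i ^ d : ℕ) : ℝ) := by
    push_cast
    rw [Real.log_pow]
    positivity
  have h2 : Real.log (1 + scale i) ≤ 2 * 2 ^ i := by
    have h3 : Real.log (1 + scale i) ≤ Real.log (2 * scale i) :=
      Real.log_le_log (by linarith) (by linarith)
    rw [Real.log_mul (by norm_num) (by linarith)] at h3
    have := Real.log_two_lt_d9
    linarith
  have h2' : 0 ≤ Real.log (1 + scale i) := Real.log_nonneg (by linarith)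
  rw [← mul_assoc, ← ENNReal.ofReal_mul (pow_nonneg h1' m),
    mul_right_comm (ENNReal.ofReal ((8 + 2 * (d : ℝ)) ^ m * (8 * K) ^ d)),
    ← ENNReal.ofReal_mul (by positivity)]
  refine mul_le_mul_left (ENNReal.ofReal_le_ofReal ?_) _
  calc (8 + 2 * Real.log ((scale i ^ d : ℕ) : ℝ)) ^ m * (4 * K * Real.log (1 + scale i)) ^ d
      ≤ ((8 + 2 * d) * 2 ^ i) ^ m * (4 * K * (2 * 2 ^ i)) ^ d := by gcongr
    _ = (8 + 2 * d) ^ m * (8 * K) ^ d * ((2 : ℝ) ^ i) ^ (d + m) := by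
      rw [pow_add, mul_pow, show (4 * K * (2 * 2 ^ i) : ℝ) = 8 * K * 2 ^ i by ring,
        mul_pow (8 * (K : ℝ))]
      ring

lemma iUnion_cube_eq_univ (m d : ℕ) :
    (⋃ K : ℕ, Set.univ.pi fun _ : Fin m => Set.univ.pi fun _ : Fin d =>
      Set.Icc (-K : ℝ) K) = Set.univ := by
  refine Set.eq_univ_of_forall fun α => ?_
  obtain ⟨K, hK⟩ := exists_nat_ge (∑ j, ∑ i, |α j i|)
  refine Set.mem_iUnion.2 ⟨K, fun j _ i _ => ?_⟩
  rw [Set.mem_Icc, ← abs_le]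
  refine le_trans ?_ hK
  refine le_trans ?_ (Finset.single_le_sum (f := fun j => ∑ i, |α j i|)
    (fun _ _ => Finset.sum_nonneg fun _ _ => abs_nonneg _) (Finset.mem_univ j))
  exact Finset.single_le_sum (f := fun i => |α j i|) (fun _ _ => abs_nonneg _) (Finset.mem_univ i)

/-- Divided by its claimed size, the i-th sum has mean O(2^(-εi)) on each cube of coefficients. The
total over i is therefore integrable, hence almost everywhere finite, and its value bounds every
term. -/
lemma ae_exists_weightedPeakSum_le (m d : ℕ) {ε : ℝ} (hε : 0 < ε) :
    ∀ᵐ α : Fin m → Fin d → ℝ, ∃ C : ℝ, 0 ≤ C ∧ ∀ i : ℕ,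
      weightedPeakSum (1 / ((scale i ^ d : ℕ) : ℝ)) (scale i) α ≤
        ENNReal.ofReal (C * ((2 : ℝ) ^ i) ^ (((d + m : ℕ) : ℝ) + ε)) := by
  -- Means are available only on bounded sets, so the space is exhausted by countably many cubes.
  rw [← Measure.restrict_univ (μ := volume), ← iUnion_cube_eq_univ m d, ae_restrict_iUnion_iff]
  intro K
  rw [volume_pi, Measure.restrict_pi_pi]
  simp_rw [volume_pi, Measure.restrict_pi_pi]
  change ∀ᵐ α ∂(Measure.pi fun _ : Fin m => cubeMeasure d K), _
  obtain ⟨C, hC, hbound⟩ := lintegral_weightedPeakSum_scale_le m d K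
  set s : ℝ := ((d + m : ℕ) : ℝ) + ε with hs
  have hpos : ∀ i : ℕ, (0 : ℝ) < ((2 : ℝ) ^ i) ^ s := fun i => by positivity
  have hmeas : ∀ i : ℕ, Measurable fun α : Fin m → Fin d → ℝ =>
      ENNReal.ofReal ((((2 : ℝ) ^ i) ^ s)⁻¹) *
        weightedPeakSum (1 / ((scale i ^ d : ℕ) : ℝ)) (scale i) α :=
    fun i => measurable_const.mul (measurable_weightedPeakSum _ _)
  have hfin : ∫⁻ α, ∑' i : ℕ, ENNReal.ofReal ((((2 : ℝ) ^ i) ^ s)⁻¹) *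
      weightedPeakSum (1 / ((scale i ^ d : ℕ) : ℝ)) (scale i) α
      ∂(Measure.pi fun _ : Fin m => cubeMeasure d K) ≠ ⊤ := by
    rw [lintegral_tsum fun i => (hmeas i).aemeasurable]
    refine ne_top_of_le_ne_top (b := ∑' i : ℕ, C * ENNReal.ofReal (((2 : ℝ) ^ (-ε)) ^ i)) ?_ ?_
    · rw [ENNReal.tsum_mul_left]
      refine ENNReal.mul_ne_top hC ?_
      have hlt : (2 : ℝ) ^ (-ε) < 1 := Real.rpow_lt_one_of_one_lt_of_neg (by norm_num) (by linarith)
      rw [← ENNReal.ofReal_tsum_of_nonneg (fun i => by positivity)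
        (summable_geometric_of_lt_one (by positivity) hlt)]
      exact ENNReal.ofReal_ne_top
    · refine ENNReal.tsum_le_tsum fun i => ?_
      rw [lintegral_const_mul _ (measurable_weightedPeakSum _ _)]
      refine (mul_le_mul_right (hbound i) _).trans_eq ?_
      rw [mul_left_comm, ← ENNReal.ofReal_mul (inv_nonneg.2 (hpos i).le)]
      congr 2
      rw [hs, Real.rpow_add (by positivity), Real.rpow_natCast, ← Real.rpow_natCast (2 ^ (-ε)),
        ← Real.rpow_natCast 2 i, ← Real.rpow_mul (by norm_num), ← Real.rpow_mul (by norm_num),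
        mul_inv, mul_right_comm, inv_mul_cancel₀ (by positivity), one_mul,
        ← Real.rpow_neg (by norm_num)]
      congr 1
      ring
  filter_upwards [ae_lt_top (Measurable.tsum hmeas) hfin] with α hα
  refine ⟨(∑' i : ℕ, ENNReal.ofReal ((((2 : ℝ) ^ i) ^ s)⁻¹) *
    weightedPeakSum (1 / ((scale i ^ d : ℕ) : ℝ)) (scale i) α).toReal,
    ENNReal.toReal_nonneg, fun i => ?_⟩
  have h1 := (ENNReal.le_tsum i).trans_eq (ENNReal.ofReal_toReal hα.ne).symm
  have h2 := mul_le_mul_right h1 (ENNReal.ofReal (((2 : ℝ) ^ i) ^ s))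
  rw [← mul_assoc, ← ENNReal.ofReal_mul (hpos i).le, mul_inv_cancel₀ (hpos i).ne',
    ENNReal.ofReal_one, one_mul, ← ENNReal.ofReal_mul (hpos i).le, mul_comm (_ ^ s)] at h2
  exact h2

/-- For almost every matrix of coefficients the values of the linear forms at the integer points of
large cubes have small discrepancy with respect to boxes. -/
theorem ae_exists_discrepancy_le (m d : ℕ) {ε : ℝ} (hε : 0 < ε) :
    ∀ᵐ α : Fin m → Fin d → ℝ, ∃ C : ℝ, 0 < C ∧ ∀ R : ℝ, 2 ≤ R → ∀ (p : Fin d → ℤ)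
      (t a b : Fin m → ℝ), (∀ j, a j ≤ b j) → (∀ j, b j ≤ a j + 1) →
      |(∑ q ∈ intBox p ⌊R⌋₊, ∏ j, arcIndicator (a j) (b j) (t j - ∑ i, α j i * q i)) /
          (2 * (⌊R⌋₊ : ℝ) + 1) ^ d - ∏ j, (b j - a j)| ≤
        C * (Real.log R ^ (((d + m : ℕ) : ℝ) + ε) / R ^ d) := by
  filter_upwards [ae_exists_weightedPeakSum_le m d hε] with α ⟨C₀, hC₀, hα⟩
  set s : ℝ := ((d + m : ℕ) : ℝ) + ε with hs
  have hs0 : 0 ≤ s := by positivity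
  refine ⟨2 ^ m * (2 ^ m * 2 ^ d + 6 ^ d * C₀) * 4 ^ s, by positivity, ?_⟩
  intro R hR p t a b hab hba
  set N := ⌊R⌋₊ with hNdef
  have hN : 2 ≤ N := Nat.le_floor (by exact_mod_cast hR)
  have hN' : (2 : ℝ) ≤ N := by exact_mod_cast hN
  have hNR : (N : ℝ) ≤ R := Nat.floor_le (by linarith)
  have hRN : R < N + 1 := Nat.lt_floor_add_one R
  obtain ⟨i, hi, hlog⟩ := exists_le_scale hN
  have hsc : (N : ℝ) ≤ scale i := by exact_mod_cast hi
  have hD : (N : ℝ) ^ d ≤ ((scale i ^ d : ℕ) : ℝ) := by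
    push_cast
    gcongr
  have hND : (0 : ℝ) < N ^ d := by positivity
  have hδ : (0 : ℝ) < 1 / ((scale i ^ d : ℕ) : ℝ) := one_div_pos.2 (hND.trans_le hD)
  have hδ1 : 1 / ((scale i ^ d : ℕ) : ℝ) ≤ 1 := by
    rw [div_le_one (hND.trans_le hD)]
    exact_mod_cast Nat.one_le_pow _ _ (one_le_scale i)
  have hlogR : Real.log N ≤ Real.log R := Real.log_le_log (by linarith) hNR
  have h2i : ((2 : ℝ) ^ i) ^ s ≤ 4 ^ s * Real.log R ^ s := by
    rw [← Real.mul_rpow (by norm_num) (Real.log_nonneg (by linarith))]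
    exact Real.rpow_le_rpow (by positivity) (by linarith) hs0
  have hone : (1 : ℝ) ≤ ((2 : ℝ) ^ i) ^ s := Real.one_le_rpow (one_le_pow₀ (by norm_num)) hs0
  have hmain := abs_boxCount_sub_le (by omega : 1 ≤ N) hsc p t hab hba hδ hδ1
    (mul_nonneg hC₀ (by positivity)) (hα i)
  set n : ℝ := (2 * (N : ℝ) + 1) ^ d with hn
  have hn0 : 0 < n := by positivity
  have hRn : R ^ d ≤ n := by
    rw [hn]
    gcongr
    linarith
  have hRd : 0 < R ^ d := by positivity
  have hR2 : R ^ d ≤ 2 ^ d * N ^ d := by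
    rw [← mul_pow]
    gcongr
    linarith
  -- The ramp width is small enough for the smoothing error to be O(R⁻ᵈ), as `R ≤ 2 * N ≤ 2 * scale
  -- i`.
  have h1 : 1 / ((scale i ^ d : ℕ) : ℝ) ≤ 2 ^ d / R ^ d := by
    rw [div_le_div_iff₀ (hND.trans_le hD) hRd]
    nlinarith [mul_le_mul_of_nonneg_left hD (by positivity : (0 : ℝ) ≤ 2 ^ d)]
  set δ := 1 / ((scale i ^ d : ℕ) : ℝ)
  set X := ((2 : ℝ) ^ i) ^ s
  set S := ∑ q ∈ intBox p N, ∏ j, arcIndicator (a j) (b j) (t j - ∑ i, α j i * q i)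
  have h2 : S / n - ∏ j, (b j - a j) = (S - n * ∏ j, (b j - a j)) / n := by
    field_simp
  rw [h2, abs_div, abs_of_pos hn0]
  calc |S - n * ∏ j, (b j - a j)| / n
      ≤ 2 ^ m * (n * (2 ^ m * δ) + 6 ^ d * (C₀ * X)) / n := by gcongr
    _ = 2 ^ m * (2 ^ m * δ + 6 ^ d * C₀ * X / n) := by field_simp
    _ ≤ 2 ^ m * (2 ^ m * (2 ^ d / R ^ d * X) + 6 ^ d * C₀ * X / R ^ d) := by
        gcongr
        exact h1.trans (le_mul_of_one_le_right (by positivity) hone)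
    _ = 2 ^ m * (2 ^ m * 2 ^ d + 6 ^ d * C₀) * X / R ^ d := by ring
    _ ≤ 2 ^ m * (2 ^ m * 2 ^ d + 6 ^ d * C₀) * (4 ^ s * Real.log R ^ s) / R ^ d := by gcongr
    _ = 2 ^ m * (2 ^ m * 2 ^ d + 6 ^ d * C₀) * 4 ^ s * (Real.log R ^ s / R ^ d) := by ring

/-! ### Points and patches of a regular cut and project set -/

section geometry

variable {d m : ℕ} {L : (Fin d → ℝ) →ₗ[ℝ] (Fin m → ℝ)} {F : Submodule ℝ (TotalSpace d m)}
  {hF : IsCompl (physicalSpace L) F}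

/-- A point and its image under π* differ by an element of E, so adding E to the window or to the
cube gives the same set. In particular the slice does not depend on F. -/
lemma mem_slice {z : TotalSpace d m} :
    z ∈ slice L F hF ↔ ∀ j, z.2 j - L z.1 j ∈ Set.Icc (0 : ℝ) 1 := by
  have hstar : ∀ c, projStar L F hF c = c - proj L F hF c := fun c =>
    Submodule.projection_eq_self_sub_projection hF c
  have hproj : ∀ c, proj L F hF c ∈ physicalSpace L := fun c =>
    Submodule.projection_apply_mem hF c
  constructor
  · rintro ⟨_, ⟨c, hc, rfl⟩, e, he, rfl⟩ j
    have h1 : e - proj L F hF c ∈ physicalSpace L := Submodule.sub_mem _ he (hproj c)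
    have h2 : projStar L F hF c + e = c + (e - proj L F hF c) := by
      rw [hstar]
      abel
    have h3 := (LinearMap.mem_graph_iff _ _).1 h1
    have h4 : (projStar L F hF c + e).2 - L (projStar L F hF c + e).1 = c.2 := by
      rw [h2, Prod.snd_add, Prod.fst_add, hc.1, zero_add, h3, add_sub_cancel_right]
    have h5 := congrFun h4 j
    rw [Pi.sub_apply] at h5
    change (projStar L F hF c + e).2 j - L (projStar L F hF c + e).1 j ∈ _
    rw [h5]
    exact hc.2 j
  · intro hz
    set c : TotalSpace d m := (0, z.2 - L z.1) with hc
    refine ⟨projStar L F hF c, ⟨c, ⟨rfl, fun j => hz j⟩, rfl⟩, proj L F hF c + (z - c), ?_, ?_⟩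
    · refine Submodule.add_mem _ (hproj c) ((LinearMap.mem_graph_iff _ _).2 ?_)
      simp [hc]
    · change projStar L F hF c + (proj L F hF c + (z - c)) = z
      rw [hstar]
      abel

/-- An integer translation in the last m coordinates brings `z` into the slice, with j-th internal
coordinate 0. Lowering that coordinate slightly leaves the slice, so the translate would be a
boundary point of the shifted lattice. -/
lemma IsRegular.sub_ne_intCast {s : TotalSpace d m} (hs : IsRegular L F hF s) {z : TotalSpace d m}
    (hz : z ∈ shiftedLattice s) (j : Fin m) (n : ℤ) : z.2 j - L z.1 j ≠ n := by
  intro hn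
  set w : TotalSpace d m := (z.1, fun j => z.2 j - ⌊z.2 j - L z.1 j⌋) with hw
  have hw1 : w.1 = z.1 := rfl
  have hw2 : ∀ j, w.2 j - L w.1 j = Int.fract (z.2 j - L z.1 j) := by
    intro j
    change z.2 j - ⌊z.2 j - L z.1 j⌋ - L z.1 j = _
    rw [Int.fract]
    ring
  have hwl : w ∈ shiftedLattice s := by
    refine ⟨hz.1, fun j => ?_⟩
    obtain ⟨b, hb⟩ := hz.2 j
    refine ⟨b - ⌊z.2 j - L z.1 j⌋, ?_⟩
    change z.2 j - ⌊z.2 j - L z.1 j⌋ - s.2 j = _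
    change z.2 j - s.2 j = b at hb
    push_cast
    linarith
  have hws : w ∈ slice L F hF := mem_slice.2 fun j => by
    rw [hw2]
    exact ⟨Int.fract_nonneg _, (Int.fract_lt_one _).le⟩
  have hwi : w ∉ interior (slice L F hF) := by
    intro hi
    have hcont : Continuous fun η : ℝ =>
        ((w.1, w.2 - η • Pi.single j (1 : ℝ)) : TotalSpace d m) := by fun_prop
    have h0 : ((w.1, w.2 - (0 : ℝ) • Pi.single j (1 : ℝ)) : TotalSpace d m) ∈
        interior (slice L F hF) := by
      rw [zero_smul, sub_zero]
      exact hi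
    have hev := hcont.continuousAt.eventually (isOpen_interior.mem_nhds h0)
    obtain ⟨η, hη, hη0⟩ := ((hev.filter_mono nhdsWithin_le_nhds).and
      (self_mem_nhdsWithin (a := (0 : ℝ)) (s := Set.Ioi 0))).exists
    have h1 := (mem_slice.1 (interior_subset hη) j).1
    have h2 := hw2 j
    rw [hn, Int.fract_intCast] at h2
    simp only [Pi.sub_apply, Pi.smul_apply, Pi.single_eq_same, smul_eq_mul, mul_one] at h1
    have h3 : 0 < η := hη0
    linarith
  have : w ∈ frontier (slice L F hF) ∩ shiftedLattice s :=
    ⟨⟨subset_closure hws, hwi⟩, hwl⟩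
  rw [hs] at this
  exact this

/-- The lattice point with coordinates `a` and `b`. -/
def latticePoint (a : Fin d → ℤ) (b : Fin m → ℤ) : TotalSpace d m :=
  (fun i => a i, fun j => b j)

lemma latticePoint_mem (a : Fin d → ℤ) (b : Fin m → ℤ) : latticePoint a b ∈ lattice d m :=
  ⟨fun i => ⟨a i, rfl⟩, fun j => ⟨b j, rfl⟩⟩

lemma latticePoint_inj {a a' : Fin d → ℤ} {b b' : Fin m → ℤ}
    (h : latticePoint a b = latticePoint a' b') : a = a' ∧ b = b' := by
  constructor
  · ext i
    have := congrFun (congrArg Prod.fst h) i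
    exact Int.cast_injective (α := ℝ) this
  · ext j
    have := congrFun (congrArg Prod.snd h) j
    exact Int.cast_injective (α := ℝ) this

lemma latticePoint_sub (a a' : Fin d → ℤ) (b b' : Fin m → ℤ) :
    latticePoint a b - latticePoint a' b' = latticePoint (a - a') (b - b') := by
  ext <;> simp [latticePoint]

/-- The internal coordinates, modulo `ℤᵐ`, of the points of `ℤᵏ + s` above `a`. -/
def internalCoord (L : (Fin d → ℝ) →ₗ[ℝ] (Fin m → ℝ)) (s : TotalSpace d m) (a : Fin d → ℤ)
    (j : Fin m) : ℝ :=
  s.2 j - L s.1 j - L (fun i => (a i : ℝ)) j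

/-- The point of `ℤᵏ + s` in the slice whose first coordinates are given by `a`. -/
def slicePoint (L : (Fin d → ℝ) →ₗ[ℝ] (Fin m → ℝ)) (s : TotalSpace d m) (a : Fin d → ℤ) :
    TotalSpace d m :=
  latticePoint a (fun j => -⌊internalCoord L s a j⌋) + s

lemma latticePoint_add_sub (s : TotalSpace d m) (a : Fin d → ℤ) (b : Fin m → ℤ) (j : Fin m) :
    (latticePoint a b + s).2 j - L (latticePoint a b + s).1 j = b j + internalCoord L s a j := by
  rw [Prod.fst_add, map_add]
  simp only [latticePoint, Prod.snd_add, Pi.add_apply, internalCoord]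
  ring

lemma slicePoint_mem_shiftedLattice (s : TotalSpace d m) (a : Fin d → ℤ) :
    slicePoint L s a ∈ shiftedLattice s := by
  rw [shiftedLattice, Set.mem_ofPred_eq, slicePoint, add_sub_cancel_right]
  exact latticePoint_mem _ _

lemma slicePoint_mem_slice (s : TotalSpace d m) (a : Fin d → ℤ) :
    slicePoint L s a ∈ slice L F hF := by
  refine mem_slice.2 fun j => ?_
  rw [slicePoint, latticePoint_add_sub]
  push_cast
  rw [neg_add_eq_sub, Int.self_sub_floor]
  exact ⟨Int.fract_nonneg _, (Int.fract_lt_one _).le⟩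

lemma exists_eq_slicePoint {s : TotalSpace d m} (hs : IsRegular L F hF s) {z : TotalSpace d m}
    (hz : z ∈ slice L F hF ∩ shiftedLattice s) : ∃ a, z = slicePoint L s a := by
  obtain ⟨hzs, hzl⟩ := hz
  choose a ha using hzl.1
  choose b hb using hzl.2
  have hz : z = latticePoint a b + s := by
    rw [← sub_eq_iff_eq_add]
    ext i
    · exact ha i
    · exact hb i
  refine ⟨a, ?_⟩
  rw [hz, slicePoint]
  congr 2
  ext j
  have h1 := mem_slice.1 hzs j
  -- The closed window allows both 0 and 1. Regularity excludes 1, which makes the integer part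
  -- unique.
  have h2 := hs.sub_ne_intCast hzl j 1
  rw [hz, latticePoint_add_sub] at h1 h2
  have h3 : ⌊internalCoord L s a j⌋ = -b j := by
    rw [Int.floor_eq_iff]
    push_cast at h2 ⊢
    exact ⟨by linarith [h1.1], by linarith [lt_of_le_of_ne h1.2 h2]⟩
  rw [h3, neg_neg]

lemma slicePoint_sub (s : TotalSpace d m) (a a' : Fin d → ℤ) :
    slicePoint L s a' - slicePoint L s a = latticePoint (a' - a)
      (fun j => ⌊internalCoord L s a j⌋ - ⌊internalCoord L s a' j⌋) := by
  rw [slicePoint, slicePoint, add_sub_add_right_eq_sub, latticePoint_sub]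
  congr 1
  ext j
  simp only [Pi.sub_apply]
  ring

/-- Relative positions see `s` and `a` only through the fractional parts of the internal
coordinates; patches inherit this. -/
lemma slicePoint_sub_eq (s : TotalSpace d m) (a q : Fin d → ℤ) :
    slicePoint L s (a + q) - slicePoint L s a = latticePoint q
      (fun j => -⌊Int.fract (internalCoord L s a j) - L (fun i => (q i : ℝ)) j⌋) := by
  rw [slicePoint_sub, add_sub_cancel_left]
  congr 1
  ext j
  have h1 : (fun i => ((a + q) i : ℝ)) = (fun i => (a i : ℝ)) + fun i => (q i : ℝ) := by
    ext i
    simp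
  have h2 : internalCoord L s (a + q) j = Int.fract (internalCoord L s a j) -
      L (fun i => (q i : ℝ)) j + ⌊internalCoord L s a j⌋ := by
    rw [Int.fract]
    simp only [internalCoord]
    rw [h1, map_add, Pi.add_apply]
    ring
  rw [h2, Int.floor_add_intCast]
  ring

lemma mem_intBox_iff {p q : Fin d → ℤ} {R : ℝ} (hR : 0 ≤ R) :
    q ∈ intBox p ⌊R⌋₊ ↔ ∀ i, ((q i - p i : ℤ) : ℝ) ∈ Set.Icc (-R) R := by
  rw [intBox, Fintype.mem_piFinset]
  refine forall_congr' fun i => ?_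
  have h : ((⌊R⌋₊ : ℕ) : ℤ) = ⌊R⌋ := by
    rw [← Int.floor_toNat, Int.toNat_of_nonneg (Int.floor_nonneg.2 hR)]
  rw [Finset.mem_Icc, Set.mem_Icc, h, neg_le, ← Int.cast_neg, ← Int.le_floor, ← Int.le_floor]
  omega

lemma latticePoint_mem_cylinder {p q : Fin d → ℤ} (b : Fin m → ℤ) {R : ℝ} (hR : 0 ≤ R) :
    latticePoint (q - p) b ∈ cylinder d m R ↔ q ∈ intBox p ⌊R⌋₊ := by
  rw [mem_intBox_iff hR]
  exact ⟨fun h => h.2, fun h => ⟨latticePoint_mem _ _, h⟩⟩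

lemma injOn_shiftedLattice (hinj : Set.InjOn (proj L F hF) (lattice d m)) (s : TotalSpace d m) :
    Set.InjOn (proj L F hF) (shiftedLattice s) := by
  intro z hz z' hz' h
  have := hinj hz hz' (by rw [map_sub, map_sub, h])
  exact sub_left_injective this

lemma lift_proj_slicePoint (hinj : Set.InjOn (proj L F hF) (lattice d m)) (s : TotalSpace d m)
    (a : Fin d → ℤ) : lift L F hF s (proj L F hF (slicePoint L s a)) = slicePoint L s a :=
  (injOn_shiftedLattice hinj s).leftInvOn_invFunOn (slicePoint_mem_shiftedLattice s a)

lemma proj_slicePoint_injective (hinj : Set.InjOn (proj L F hF) (lattice d m))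
    (s : TotalSpace d m) : Function.Injective fun a => proj L F hF (slicePoint L s a) := by
  intro a a' h
  have := injOn_shiftedLattice hinj s (slicePoint_mem_shiftedLattice s a)
    (slicePoint_mem_shiftedLattice s a') h
  exact (latticePoint_inj (add_right_cancel this)).1

lemma mem_cutProjectSet_iff {s : TotalSpace d m} (hs : IsRegular L F hF s) {y : TotalSpace d m} :
    y ∈ cutProjectSet L F hF s ↔ ∃ a, proj L F hF (slicePoint L s a) = y := by
  constructor
  · rintro ⟨z, hz, rfl⟩
    obtain ⟨a, rfl⟩ := exists_eq_slicePoint hs hz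
    exact ⟨a, rfl⟩
  · rintro ⟨a, rfl⟩
    exact ⟨_, ⟨slicePoint_mem_slice s a, slicePoint_mem_shiftedLattice s a⟩, rfl⟩

/-- Through lifts, cylinder conditions become integer cubes in ℤᵈ. The predicate `Q` lets one
statement serve patches and both counts in the frequency ratio. -/
lemma searchRegion_eq (hinj : Set.InjOn (proj L F hF) (lattice d m)) {s : TotalSpace d m}
    (hs : IsRegular L F hF s) (a : Fin d → ℤ) {R : ℝ} (hR : 0 ≤ R) (Q : TotalSpace d m → Prop) :
    {y' | y' ∈ cutProjectSet L F hF s ∧ Q y' ∧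
      lift L F hF s y' - lift L F hF s (proj L F hF (slicePoint L s a)) ∈ cylinder d m R} =
    (fun a' => proj L F hF (slicePoint L s a')) ''
      {a' | a' ∈ intBox a ⌊R⌋₊ ∧ Q (proj L F hF (slicePoint L s a'))} := by
  ext y
  constructor
  · rintro ⟨hy, hQ, hc⟩
    obtain ⟨a', rfl⟩ := (mem_cutProjectSet_iff hs).1 hy
    rw [lift_proj_slicePoint hinj, lift_proj_slicePoint hinj, slicePoint_sub,
      latticePoint_mem_cylinder _ hR] at hc
    exact ⟨a', ⟨hc, hQ⟩, rfl⟩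
  · rintro ⟨a', ⟨hc, hQ⟩, rfl⟩
    refine ⟨(mem_cutProjectSet_iff hs).2 ⟨a', rfl⟩, hQ, ?_⟩
    rw [lift_proj_slicePoint hinj, lift_proj_slicePoint hinj, slicePoint_sub,
      latticePoint_mem_cylinder _ hR]
    exact hc

lemma patchClass_eq_image (hinj : Set.InjOn (proj L F hF) (lattice d m)) {s : TotalSpace d m}
    (hs : IsRegular L F hF s) (a : Fin d → ℤ) {r : ℝ} (hr : 0 ≤ r) :
    patchClass L F hF s r (proj L F hF (slicePoint L s a)) =
      (fun q => proj L F hF (latticePoint q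
        (fun j => -⌊Int.fract (internalCoord L s a j) - L (fun i => (q i : ℝ)) j⌋))) ''
        (intBox (0 : Fin d → ℤ) ⌊r⌋₊ : Set (Fin d → ℤ)) := by
  have h := searchRegion_eq hinj hs a hr fun _ => True
  simp only [true_and, and_true] at h
  rw [patchClass, patch, h, Set.image_image]
  have hmem : ∀ q, a + q ∈ intBox a ⌊r⌋₊ ↔ q ∈ intBox 0 ⌊r⌋₊ := by
    intro q
    rw [mem_intBox_iff hr, mem_intBox_iff hr]
    simp
  ext y
  constructor
  · rintro ⟨a', ha', rfl⟩
    refine ⟨a' - a, ?_, ?_⟩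
    · rw [Finset.mem_coe, ← hmem, add_sub_cancel]
      exact ha'
    · change proj L F hF _ = proj L F hF _ - proj L F hF _
      rw [← slicePoint_sub_eq, add_sub_cancel, map_sub]
  · rintro ⟨q, hq, rfl⟩
    refine ⟨a + q, (hmem q).2 hq, ?_⟩
    change proj L F hF _ - proj L F hF _ = proj L F hF _
    rw [← slicePoint_sub_eq, map_sub]

/-- Injectivity of π on the lattice recovers from each vector of the patch both q and the integer
parts attached to it, so the equality of sets can be read off pointwise. -/
lemma patchClass_eq_iff (hinj : Set.InjOn (proj L F hF) (lattice d m)) {s s' : TotalSpace d m}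
    (hs : IsRegular L F hF s) (hs' : IsRegular L F hF s') (a a' : Fin d → ℤ) {r : ℝ}
    (hr : 0 ≤ r) :
    patchClass L F hF s r (proj L F hF (slicePoint L s a)) =
        patchClass L F hF s' r (proj L F hF (slicePoint L s' a')) ↔
      ∀ j, ∀ q ∈ intBox (0 : Fin d → ℤ) ⌊r⌋₊,
        ⌊Int.fract (internalCoord L s a j) - L (fun i => (q i : ℝ)) j⌋ =
          ⌊Int.fract (internalCoord L s' a' j) - L (fun i => (q i : ℝ)) j⌋ := by
  rw [patchClass_eq_image hinj hs a hr, patchClass_eq_image hinj hs' a' hr]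
  constructor
  · intro h j q hq
    have h1 := h.subset (Set.mem_image_of_mem _ (Finset.mem_coe.2 hq))
    obtain ⟨q', -, hq'⟩ := h1
    obtain ⟨rfl, h2⟩ := latticePoint_inj (hinj (latticePoint_mem _ _) (latticePoint_mem _ _) hq')
    have := congrFun h2 j
    simpa using this.symm
  · intro h
    refine Set.image_congr fun q hq => ?_
    congr 2
    ext j
    rw [h j q (Finset.mem_coe.1 hq)]

end geometry

/-! ### Acceptance boxes and frequencies -/

/-- The points whose translates by `ℓ q` have prescribed integer parts form a half-open interval. -/
lemma exists_interval_floor_sub_eq {ι : Type*} (S : Finset ι) (ℓ : ι → ℝ)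
    (hS : ∃ q ∈ S, ℓ q = 0) {v₀ : ℝ} (hv₀ : ⌊v₀⌋ = 0) :
    ∃ A B : ℝ, 0 ≤ A ∧ A ≤ B ∧ B ≤ 1 ∧
      ∀ v, (∀ q ∈ S, ⌊v - ℓ q⌋ = ⌊v₀ - ℓ q⌋) ↔ A ≤ v ∧ v < B := by
  obtain ⟨q₀, hq₀, hℓ⟩ := hS
  have hne : S.Nonempty := ⟨q₀, hq₀⟩
  -- Each q confines v to a half-open unit interval, and these are intersected. The index with `ℓ q
  -- = 0` contributes [0, 1), and `v₀` shows that the intersection is nonempty.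
  refine ⟨S.sup' hne fun q => ⌊v₀ - ℓ q⌋ + ℓ q, S.inf' hne fun q => ⌊v₀ - ℓ q⌋ + ℓ q + 1,
    ?_, ?_, ?_, ?_⟩
  · refine le_trans (le_of_eq ?_) (Finset.le_sup' _ hq₀)
    simp [hℓ, hv₀]
  · refine le_trans (b := v₀) ?_ ?_
    · refine Finset.sup'_le _ _ fun q _ => ?_
      linarith [Int.floor_le (v₀ - ℓ q)]
    · refine Finset.le_inf' _ _ fun q _ => ?_
      linarith [Int.lt_floor_add_one (v₀ - ℓ q)]
  · refine (Finset.inf'_le _ hq₀).trans (le_of_eq ?_)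
    simp [hℓ, hv₀]
  · intro v
    rw [Finset.sup'_le_iff, Finset.lt_inf'_iff, ← forall₂_and]
    refine forall₂_congr fun q _ => ?_
    rw [Int.floor_eq_iff]
    constructor <;> rintro ⟨h1, h2⟩ <;> constructor <;> linarith

lemma arcIndicator_eq_ite {A B : ℝ} (hA : 0 ≤ A) (hAB : A ≤ B) (hB : B ≤ 1) (u : ℝ) :
    arcIndicator A B u = if A ≤ Int.fract u ∧ Int.fract u < B then 1 else 0 := by
  have key : ∀ c, 0 ≤ c → c ≤ 1 → ⌊u - c⌋ = ⌊u⌋ + if c ≤ Int.fract u then 0 else -1 := by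
    intro c h0 h1
    have h2 := Int.fract_nonneg u
    have h3 := Int.fract_lt_one u
    have h4 := Int.floor_add_fract u
    rw [Int.floor_eq_iff]
    split_ifs with h <;> push_cast <;> constructor <;> linarith
  rw [arcIndicator, key A hA (hAB.trans hB), key B (hA.trans hAB) hB]
  by_cases h1 : A ≤ Int.fract u <;> by_cases h2 : B ≤ Int.fract u
  · simp [h1, h2]
  · simp [h1, h2, not_le.1 h2]
  · exact absurd (hAB.trans h2) h1
  · simp [h1, h2]

lemma prod_arcIndicator_eq_ite {m : ℕ} {A B : Fin m → ℝ} (hA : ∀ j, 0 ≤ A j)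
    (hAB : ∀ j, A j ≤ B j) (hB : ∀ j, B j ≤ 1) (u : Fin m → ℝ)
    [Decidable (∀ j, A j ≤ Int.fract (u j) ∧ Int.fract (u j) < B j)] :
    ∏ j, arcIndicator (A j) (B j) (u j) =
      if ∀ j, A j ≤ Int.fract (u j) ∧ Int.fract (u j) < B j then 1 else 0 := by
  split_ifs with h
  · refine Finset.prod_eq_one fun j _ => ?_
    rw [arcIndicator_eq_ite (hA j) (hAB j) (hB j), if_pos (h j)]
  · obtain ⟨j, hj⟩ := not_forall.1 h
    refine Finset.prod_eq_zero (Finset.mem_univ j) ?_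
    rw [arcIndicator_eq_ite (hA j) (hAB j) (hB j), if_neg hj]

section frequency

variable {d m : ℕ} {L : (Fin d → ℝ) →ₗ[ℝ] (Fin m → ℝ)} {F : Submodule ℝ (TotalSpace d m)}
  {hF : IsCompl (physicalSpace L) F}

lemma freqEstimate_eq (hinj : Set.InjOn (proj L F hF) (lattice d m)) {s : TotalSpace d m}
    (hs : IsRegular L F hF s) (a : Fin d → ℤ) {r R : ℝ} (hR : 0 ≤ R) {P : Set (TotalSpace d m)}
    {A B : Fin m → ℝ} (hA : ∀ j, 0 ≤ A j) (hAB : ∀ j, A j ≤ B j) (hB : ∀ j, B j ≤ 1)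
    (hP : ∀ a', patchClass L F hF s r (proj L F hF (slicePoint L s a')) = P ↔
      ∀ j, A j ≤ Int.fract (internalCoord L s a' j) ∧ Int.fract (internalCoord L s a' j) < B j) :
    freqEstimate L F hF s r P (proj L F hF (slicePoint L s a)) R =
      (∑ q ∈ intBox a ⌊R⌋₊, ∏ j, arcIndicator (A j) (B j) (internalCoord L s q j)) /
        (2 * (⌊R⌋₊ : ℝ) + 1) ^ d := by
  classical
  have h1 := searchRegion_eq hinj hs a hR fun y' => patchClass L F hF s r y' = P
  have h2 := searchRegion_eq hinj hs a hR fun _ => True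
  simp only [true_and, and_true] at h2
  rw [freqEstimate, h1, h2, Set.ncard_image_of_injective _ (proj_slicePoint_injective hinj s),
    Set.ncard_image_of_injective _ (proj_slicePoint_injective hinj s)]
  congr 1
  · simp_rw [hP, prod_arcIndicator_eq_ite hA hAB hB]
    rw [Finset.sum_boole, ← Finset.coe_filter, Set.ncard_coe_finset]
  · rw [Finset.setOfPred_mem, Set.ncard_coe_finset, card_intBox]
    push_cast
    rfl

/-- The acceptance domain of a patch class is a box. -/
lemma IsPatchClass.exists_box (hinj : Set.InjOn (proj L F hF) (lattice d m)) {r : ℝ} (hr : 0 ≤ r)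
    {P : Set (TotalSpace d m)} (hP : IsPatchClass L F hF r P) :
    ∃ A B : Fin m → ℝ, (∀ j, 0 ≤ A j) ∧ (∀ j, A j ≤ B j) ∧ (∀ j, B j ≤ 1) ∧
      ∀ s, IsRegular L F hF s → ∀ a,
        (patchClass L F hF s r (proj L F hF (slicePoint L s a)) = P ↔ ∀ j,
          A j ≤ Int.fract (internalCoord L s a j) ∧ Int.fract (internalCoord L s a j) < B j) := by
  obtain ⟨s₀, hs₀, y₀, hy₀, rfl⟩ := hP
  obtain ⟨a₀, rfl⟩ := (mem_cutProjectSet_iff hs₀).1 hy₀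
  have hzero : (0 : Fin d → ℤ) ∈ intBox (0 : Fin d → ℤ) ⌊r⌋₊ := by
    rw [mem_intBox_iff hr]
    simp [hr]
  have h0 : L (fun i => ((0 : Fin d → ℤ) i : ℝ)) = 0 := by
    have : (fun i => ((0 : Fin d → ℤ) i : ℝ)) = 0 := by
      ext
      simp
    rw [this, map_zero]
  choose A B hA hAB hB hbox using fun j : Fin m =>
    exists_interval_floor_sub_eq (intBox (0 : Fin d → ℤ) ⌊r⌋₊) (fun q => L (fun i => (q i : ℝ)) j)
      ⟨0, hzero, by rw [h0]; rfl⟩ (Int.floor_fract (internalCoord L s₀ a₀ j))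
  refine ⟨A, B, hA, hAB, hB, fun s hs a => ?_⟩
  rw [patchClass_eq_iff hinj hs hs₀ a a₀ hr]
  exact forall_congr' fun j => hbox j _

end frequency

lemma tendsto_log_rpow_div_pow (s : ℝ) {d : ℕ} (hd : 0 < d) :
    Tendsto (fun R : ℝ => Real.log R ^ s / R ^ d) atTop (𝓝 0) := by
  have h := (isLittleO_log_rpow_rpow_atTop s (Nat.cast_pos.2 hd : (0 : ℝ) < d)).tendsto_div_nhds_zero
  simpa only [Real.rpow_natCast] using h

lemma linearMapOf_apply {d m : ℕ} (α : Fin m → Fin d → ℝ) (x : Fin d → ℝ) (j : Fin m) :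
    linearMapOf α x j = ∑ i, α j i * x i := by
  simp [linearMapOf, Matrix.mulVec, dotProduct]

end CutProject
end

theorem theorem1 (d m : ℕ) (hd : 0 < d) (hm : 0 < m) (ε : ℝ) (hε : 0 < ε) :
    ∀ᵐ α : Fin m → Fin d → ℝ,
      ∀ (F : Submodule ℝ (CutProject.TotalSpace d m))
        (hF : IsCompl (CutProject.physicalSpace (CutProject.linearMapOf α)) F),
        Set.InjOn (CutProject.proj (CutProject.linearMapOf α) F hF) (CutProject.lattice d m) →
        ∃ C : ℝ, 0 < C ∧
          ∀ (r : ℝ), 0 ≤ r → ∀ P : Set (CutProject.TotalSpace d m),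
            CutProject.IsPatchClass (CutProject.linearMapOf α) F hF r P →
            ∃ ξ : ℝ, CutProject.IsFrequency (CutProject.linearMapOf α) F hF r P ξ ∧
              ∀ s, CutProject.IsRegular (CutProject.linearMapOf α) F hF s →
                ∀ y ∈ CutProject.cutProjectSet (CutProject.linearMapOf α) F hF s,
                  ∀ R : ℝ, 2 ≤ R →
                    |CutProject.freqEstimate (CutProject.linearMapOf α) F hF s r P y R - ξ| ≤
                      C * (Real.log R ^ (((d + m : ℕ) : ℝ) + ε) / R ^ d) := by
  filter_upwards [CutProject.ae_exists_discrepancy_le m d hε] with α ⟨C, hC, hdisc⟩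
  intro F hF hinj
  refine ⟨C, hC, fun r hr P hP => ?_⟩
  obtain ⟨A, B, hA, hAB, hB, hbox⟩ := hP.exists_box hinj hr
  have hbound : ∀ s, CutProject.IsRegular (CutProject.linearMapOf α) F hF s →
      ∀ y ∈ CutProject.cutProjectSet (CutProject.linearMapOf α) F hF s, ∀ R : ℝ, 2 ≤ R →
        |CutProject.freqEstimate (CutProject.linearMapOf α) F hF s r P y R - ∏ j, (B j - A j)| ≤
          C * (Real.log R ^ (((d + m : ℕ) : ℝ) + ε) / R ^ d) := by
    intro s hs y hy R hR
    obtain ⟨a, rfl⟩ := (CutProject.mem_cutProjectSet_iff hs).1 hy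
    rw [CutProject.freqEstimate_eq hinj hs a (by linarith) hA hAB hB (hbox s hs)]
    -- The shift `s` enters only as the translation of the forms, and `y` only as the centre `a` of
    -- the cube. The discrepancy bound is uniform in both, and its constant was fixed before F and
    -- the patch class.
    have h := hdisc R hR a (fun j => s.2 j - CutProject.linearMapOf α s.1 j) A B hAB
      fun j => (hB j).trans (by linarith [hA j])
    simpa only [CutProject.internalCoord, CutProject.linearMapOf_apply] using h
  refine ⟨∏ j, (B j - A j), fun s hs y hy => ?_, hbound⟩
  rw [tendsto_iff_norm_sub_tendsto_zero]
  have hlim := (CutProject.tendsto_log_rpow_div_pow (((d + m : ℕ) : ℝ) + ε) hd).const_mul C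
  rw [mul_zero] at hlim
  refine squeeze_zero' (Eventually.of_forall fun _ => norm_nonneg _) ?_ hlim
  filter_upwards [eventually_ge_atTop 2] with R hR
  exact hbound s hs y hy R hR
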